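/- **Setting.** Types are generated from the type $0$ of natural numbers and a unit type $1$ by $\rho\to\sigma$ and $\rho\times\sigma$. Terms are those of the typed $\lambda$-calculus with abstraction, application, pairs $(t,s)$, projections $t_1,t_2$, a constant of type $1$, the constants $0$ and $S$, and primitive recursion at every type; terms are identified up to the conversion (congruence) generated by $\beta$, the projection equations and the recursion equations, in the sense that $A(t)$ may be inferred from $A(s)$ when $s$ and $t$ are convertible. Prime formulas are $\bot$ and equations $t=_0s$ between terms of type $0$; formulas are built by $\wedge,\vee,\to$ and by $\forall x^\rho,\exists x^\rho$ for all types $\rho$; $\neg A:=A\to\bot$. $\mathrm{HA}^\omega$ is intuitionistic natural deduction for this many-sorted language with reflexivity and replacement for $=_0$, the Peano axioms for $S$, and induction for all formulas. $\mathrm{PA}^\omega$ is $\mathrm{HA}^\omega$ with the schema $A\vee\neg A$. Consider the schemata (with parameters) $$\mathrm{DNS}^\rho:\ \forall x^\rho\neg\neg A(x)\to\neg\neg\forall x^\rho A(x),\qquad \mathrm{AC}^{\rho,\sigma}:\ \forall x^\rho\exists y^\sigma A(x,y)\to\exists f^{\rho\to\sigma}\forall x^\rho A(x,f(x)).$$ $\mathrm{DNS}^\omega$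 and $\mathrm{AC}^\omega$ denote all instances at all types; $\mathrm{AC}^0$ denotes $\mathrm{AC}^{0,\sigma}$ for all $\sigma$. A formula is arithmetical if all its quantifiers have type $0$. Modified realizability assigns to a formula $A$ and a term $t$, of a type determined by the logical form of $A$, the formula $t\ \mathrm{mr}\ A$: for prime $P$, $t\ \mathrm{mr}\ P:=P$ with $t$ of type $1$; $t\ \mathrm{mr}\ (A\wedge B):=(t_1\ \mathrm{mr}\ A)\wedge(t_2\ \mathrm{mr}\ B)$; $t\ \mathrm{mr}\ (A\vee B):=(t_2=_00\to (t_1)_1\ \mathrm{mr}\ A)\wedge(t_2\neq_00\to (t_1)_2\ \mathrm{mr}\ B)$; $t\ \mathrm{mr}\ (A\to B):=\forall x(x\ \mathrm{mr}\ A\to tx\ \mathrm{mr}\ B)$; $t\ \mathrm{mr}\ \exists yA(y):=t_1\ \mathrm{mr}\ A(t_2)$; $t\ \mathrm{mr}\ \forall yA(y):=\forall y(ty\ \mathrm{mr}\ A(y))$. To every proof $d$ without excluded middle of a formula $B$, from instances of $\mathrm{AC}$ and $\mathrm{DNS}$, the usual recursion on $d$ assigns an extracted term $t_d$ of the type of realizers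 of $B$ (an instance of $\mathrm{AC}$ is assigned $\lambda g.(\lambda x.(gx)_1,\lambda x.(gx)_2)$, and an instance of $\mathrm{DNS}$ the constant functional with value in the unit type), whose free variables are among those of $d$. **Corollary.** Let $A$ be a formula, possibly with free variables. 1. If $\mathrm{PA}^\omega+\mathrm{AC}^\omega$ proves $A$, then $\mathrm{HA}^\omega+\mathrm{AC}^\omega+\mathrm{DNS}^\omega$ proves $\neg\neg A$, and for every proof $d$ of $\neg\neg A$ in $\mathrm{HA}^\omega+\mathrm{AC}^\omega+\mathrm{DNS}^\omega$ the extracted term $t_d$ realizes $\neg\neg A$ provably in that theory: $\mathrm{HA}^\omega+\mathrm{AC}^\omega+\mathrm{DNS}^\omega\vdash t_d\ \mathrm{mr}\ \neg\neg A$. 2. If $A$ is arithmetical and Classical Analysis $\mathrm{PA}^\omega+\mathrm{AC}^0$ proves $A$, then $\mathrm{HA}^\omega+\mathrm{AC}^0+\mathrm{DNS}^0$ proves $\neg\neg A$, and for every proof $d$ of $\neg\neg A$ in $\mathrm{HA}^\omega+\mathrm{AC}^0+\mathrm{DNS}^0$ one has $\mathrm{HA}^\omega+\mathrm{AC}^0+\mathrm{DNS}^0\vdash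 t_d\ \mathrm{mr}\ \neg\neg A$. -/

import Mathlib

namespace HAOmega

/-! ### Finite types and the typed lambda calculus of terms -/

/-- Finite types: the type `0` of natural numbers, the unit type, arrow and product types. -/
inductive Ty : Type
  | nat : Ty
  | unit : Ty
  | arr : Ty → Ty → Ty
  | prod : Ty → Ty → Ty

/-- Typed contexts of free (de Bruijn) variables. -/
abbrev Ctx : Type := List Ty

/-- `Var l a` is the type of positions in the list `l` at which `a` stands. It serves as the type
of variables of a context, and as the type of references to the open assumptions of a proof. -/
inductive Var {α : Type} : List α → α → Type
  | zero {l : List α} {a : α} : Var (a :: l) a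
  | succ {l : List α} {a b : α} : Var l a → Var (b :: l) a

/-- Well-typed terms; `primrec` is the recursor, at an arbitrary type. -/
inductive Term : Ctx → Ty → Type
  | var {Γ : Ctx} {σ : Ty} : Var Γ σ → Term Γ σ
  | lam {Γ : Ctx} {σ τ : Ty} : Term (σ :: Γ) τ → Term Γ (.arr σ τ)
  | app {Γ : Ctx} {σ τ : Ty} : Term Γ (.arr σ τ) → Term Γ σ → Term Γ τ
  | pair {Γ : Ctx} {σ τ : Ty} : Term Γ σ → Term Γ τ → Term Γ (.prod σ τ)
  | fst {Γ : Ctx} {σ τ : Ty} : Term Γ (.prod σ τ) → Term Γ σ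
  | snd {Γ : Ctx} {σ τ : Ty} : Term Γ (.prod σ τ) → Term Γ τ
  | star {Γ : Ctx} : Term Γ .unit
  | zero {Γ : Ctx} : Term Γ .nat
  | succ {Γ : Ctx} : Term Γ .nat → Term Γ .nat
  | primrec {Γ : Ctx} {σ : Ty} :
      Term Γ σ → Term Γ (.arr .nat (.arr σ σ)) → Term Γ .nat → Term Γ σ

/-- Renamings of variables. -/
abbrev Ren (Γ Γ' : Ctx) : Type := ∀ σ : Ty, Var Γ σ → Var Γ' σ

/-- Extension of a renaming under a binder. -/
def Ren.lift {Γ Γ' : Ctx} (r : Ren Γ Γ') (τ : Ty) : Ren (τ :: Γ) (τ :: Γ')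
  | _, .zero => .zero
  | _, .succ v => .succ (r _ v)

/-- The renaming that adds a fresh variable. -/
def Ren.wk {Γ : Ctx} (τ : Ty) : Ren Γ (τ :: Γ) := fun _ v => .succ v

def Term.rename {Γ : Ctx} {σ : Ty} : Term Γ σ → {Γ' : Ctx} → Ren Γ Γ' → Term Γ' σ
  | .var v, _, r => .var (r _ v)
  | .lam t, _, r => .lam (t.rename (r.lift _))
  | .app t u, _, r => .app (t.rename r) (u.rename r)
  | .pair t u, _, r => .pair (t.rename r) (u.rename r)
  | .fst t, _, r => .fst (t.rename r)
  | .snd t, _, r => .snd (t.rename r)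
  | .star, _, _ => .star
  | .zero, _, _ => .zero
  | .succ t, _, r => .succ (t.rename r)
  | .primrec t u n, _, r => .primrec (t.rename r) (u.rename r) (n.rename r)

/-- Weakening of a term by a fresh variable. -/
def Term.wk {Γ : Ctx} {σ : Ty} (τ : Ty) (t : Term Γ σ) : Term (τ :: Γ) σ := t.rename (Ren.wk τ)

/-- Simultaneous substitutions. -/
abbrev Sub (Γ Γ' : Ctx) : Type := ∀ σ : Ty, Var Γ σ → Term Γ' σ

/-- The identity substitution. -/
def Sub.id (Γ : Ctx) : Sub Γ Γ := fun _ v => .var v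

/-- Weakening of all values of a substitution by a fresh variable. -/
def Sub.wk {Γ Γ' : Ctx} (r : Sub Γ Γ') (τ : Ty) : Sub Γ (τ :: Γ') := fun _ v => (r _ v).wk τ

/-- Extension of a substitution by a value for one more variable. -/
def Sub.cons {Γ Γ' : Ctx} {τ : Ty} (t : Term Γ' τ) (r : Sub Γ Γ') : Sub (τ :: Γ) Γ'
  | _, .zero => t
  | _, .succ v => r _ v

/-- Extension of a substitution under a binder. -/
def Sub.lift {Γ Γ' : Ctx} (r : Sub Γ Γ') (τ : Ty) : Sub (τ :: Γ) (τ :: Γ') :=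
  Sub.cons (.var .zero) (r.wk τ)

def Term.subst {Γ : Ctx} {σ : Ty} : Term Γ σ → {Γ' : Ctx} → Sub Γ Γ' → Term Γ' σ
  | .var v, _, r => r _ v
  | .lam t, _, r => .lam (t.subst (r.lift _))
  | .app t u, _, r => .app (t.subst r) (u.subst r)
  | .pair t u, _, r => .pair (t.subst r) (u.subst r)
  | .fst t, _, r => .fst (t.subst r)
  | .snd t, _, r => .snd (t.subst r)
  | .star, _, _ => .star
  | .zero, _, _ => .zero
  | .succ t, _, r => .succ (t.subst r)
  | .primrec t u n, _, r => .primrec (t.subst r) (u.subst r) (n.subst r)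

/-- Substitution of `u` for the last variable of `t`. -/
def Term.inst {Γ : Ctx} {σ τ : Ty} (t : Term (τ :: Γ) σ) (u : Term Γ τ) : Term Γ σ :=
  t.subst (Sub.cons u (Sub.id Γ))

/-- Conversion of terms: the congruence generated by beta reduction, by the equations of the
projections and by the equations of the recursor. -/
inductive Conv : {Γ : Ctx} → {σ : Ty} → Term Γ σ → Term Γ σ → Prop
  | refl {Γ : Ctx} {σ : Ty} (t : Term Γ σ) : Conv t t
  | symm {Γ : Ctx} {σ : Ty} {t u : Term Γ σ} : Conv t u → Conv u t
  | trans {Γ : Ctx} {σ : Ty} {t u v : Term Γ σ} : Conv t u → Conv u v → Conv t v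
  | lam {Γ : Ctx} {σ τ : Ty} {t u : Term (σ :: Γ) τ} : Conv t u → Conv (.lam t) (.lam u)
  | app {Γ : Ctx} {σ τ : Ty} {t t' : Term Γ (.arr σ τ)} {u u' : Term Γ σ} :
      Conv t t' → Conv u u' → Conv (.app t u) (.app t' u')
  | pair {Γ : Ctx} {σ τ : Ty} {t t' : Term Γ σ} {u u' : Term Γ τ} :
      Conv t t' → Conv u u' → Conv (.pair t u) (.pair t' u')
  | fst {Γ : Ctx} {σ τ : Ty} {t u : Term Γ (.prod σ τ)} : Conv t u → Conv (.fst t) (.fst u)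
  | snd {Γ : Ctx} {σ τ : Ty} {t u : Term Γ (.prod σ τ)} : Conv t u → Conv (.snd t) (.snd u)
  | succ {Γ : Ctx} {t u : Term Γ .nat} : Conv t u → Conv (.succ t) (.succ u)
  | primrec {Γ : Ctx} {σ : Ty} {t t' : Term Γ σ} {u u' : Term Γ (.arr .nat (.arr σ σ))}
      {n n' : Term Γ .nat} :
      Conv t t' → Conv u u' → Conv n n' → Conv (.primrec t u n) (.primrec t' u' n')
  | beta {Γ : Ctx} {σ τ : Ty} (t : Term (σ :: Γ) τ) (u : Term Γ σ) :
      Conv (.app (.lam t) u) (t.inst u)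
  | fst_pair {Γ : Ctx} {σ τ : Ty} (t : Term Γ σ) (u : Term Γ τ) : Conv (.fst (.pair t u)) t
  | snd_pair {Γ : Ctx} {σ τ : Ty} (t : Term Γ σ) (u : Term Γ τ) : Conv (.snd (.pair t u)) u
  | primrec_zero {Γ : Ctx} {σ : Ty} (t : Term Γ σ) (u : Term Γ (.arr .nat (.arr σ σ))) :
      Conv (.primrec t u .zero) t
  | primrec_succ {Γ : Ctx} {σ : Ty} (t : Term Γ σ) (u : Term Γ (.arr .nat (.arr σ σ)))
      (n : Term Γ .nat) :
      Conv (.primrec t u (.succ n)) (.app (.app u n) (.primrec t u n))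

/-- A closed inhabitant of every type, used where a realizer is computationally irrelevant. -/
def Term.dflt {Γ : Ctx} : (σ : Ty) → Term Γ σ
  | .nat => .zero
  | .unit => .star
  | .arr _ τ => .lam (Term.dflt τ)
  | .prod σ τ => .pair (Term.dflt σ) (Term.dflt τ)

/-- Definition by cases: `t` if `n = 0`, and `u` if `n` is a successor. -/
def Term.cond {Γ : Ctx} {σ : Ty} (n : Term Γ .nat) (t u : Term Γ σ) : Term Γ σ :=
  .primrec t (.lam (.lam ((u.wk _).wk _))) n

/-! ### Formulas -/

/-- The logical form of a formula: the formula with all its terms forgotten. -/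
inductive Form : Type
  | prime : Form
  | and : Form → Form → Form
  | or : Form → Form → Form
  | imp : Form → Form → Form
  | all : Ty → Form → Form
  | ex : Ty → Form → Form

/-- Formulas with free variables in `Γ`. The second index only records the logical form of the
formula (it is determined by the formula). The prime formulas are the equations between terms of
type `0`, and falsity. -/
inductive Fm : Ctx → Form → Type
  | eq {Γ : Ctx} : Term Γ .nat → Term Γ .nat → Fm Γ .prime
  | bot {Γ : Ctx} : Fm Γ .prime
  | and {Γ : Ctx} {a b : Form} : Fm Γ a → Fm Γ b → Fm Γ (.and a b)
  | or {Γ : Ctx} {a b : Form} : Fm Γ a → Fm Γ b → Fm Γ (.or a b)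
  | imp {Γ : Ctx} {a b : Form} : Fm Γ a → Fm Γ b → Fm Γ (.imp a b)
  | all {Γ : Ctx} {σ : Ty} {a : Form} : Fm (σ :: Γ) a → Fm Γ (.all σ a)
  | ex {Γ : Ctx} {σ : Ty} {a : Form} : Fm (σ :: Γ) a → Fm Γ (.ex σ a)

/-- Logical form of a negation. -/
abbrev Form.neg (a : Form) : Form := .imp a .prime

/-- Negation. -/
abbrev Fm.neg {Γ : Ctx} {a : Form} (A : Fm Γ a) : Fm Γ a.neg := .imp A .bot

def Fm.subst {Γ : Ctx} {a : Form} : Fm Γ a → {Γ' : Ctx} → Sub Γ Γ' → Fm Γ' a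
  | .eq t u, _, r => .eq (t.subst r) (u.subst r)
  | .bot, _, _ => .bot
  | .and A B, _, r => .and (A.subst r) (B.subst r)
  | .or A B, _, r => .or (A.subst r) (B.subst r)
  | .imp A B, _, r => .imp (A.subst r) (B.subst r)
  | .all A, _, r => .all (A.subst (r.lift _))
  | .ex A, _, r => .ex (A.subst (r.lift _))

/-- Weakening of a formula by a fresh variable. -/
def Fm.wk {Γ : Ctx} {a : Form} (τ : Ty) (A : Fm Γ a) : Fm (τ :: Γ) a :=
  A.subst ((Sub.id Γ).wk τ)

/-- The formula `A(t)`, for a formula `A(x)` whose last variable is `x`. -/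
def Fm.inst {Γ : Ctx} {a : Form} {τ : Ty} (A : Fm (τ :: Γ) a) (t : Term Γ τ) : Fm Γ a :=
  A.subst (Sub.cons t (Sub.id Γ))

/-- The formula `A(S x)`, for a formula `A(x)` whose last variable is `x` of type `0`. -/
def Fm.step {Γ : Ctx} {a : Form} (A : Fm (.nat :: Γ) a) : Fm (.nat :: Γ) a :=
  A.subst (Sub.cons (.succ (.var .zero)) ((Sub.id Γ).wk .nat))

/-- A formula is arithmetical if it contains only quantifiers of type `0`. -/
def Form.Arithmetical : Form → Prop
  | .prime => True
  | .and a b => a.Arithmetical ∧ b.Arithmetical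
  | .or a b => a.Arithmetical ∧ b.Arithmetical
  | .imp a b => a.Arithmetical ∧ b.Arithmetical
  | .all σ a => σ = .nat ∧ a.Arithmetical
  | .ex σ a => σ = .nat ∧ a.Arithmetical

/-! ### The principles of choice and of double-negation shift -/

/-- The substitution `x ↦ x, y ↦ f x`, where `x, y` are the last two variables of the source
context, and `f, x` the last two variables of the target context. -/
def choiceSub (Γ : Ctx) (ρ σ : Ty) : Sub (σ :: ρ :: Γ) (ρ :: Ty.arr ρ σ :: Γ) :=
  Sub.cons (.app (.var (.succ .zero)) (.var .zero)) (((Sub.id Γ).wk (.arr ρ σ)).lift ρ)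

/-- The instance of the axiom of choice for `A(x, y)`, with `x` of type `ρ` and `y` of type `σ`:
`∀ x ∃ y A(x, y) → ∃ f ∀ x A(x, f x)`. -/
def acFm {Γ : Ctx} {ρ σ : Ty} {a : Form} (A : Fm (σ :: ρ :: Γ) a) :
    Fm Γ (.imp (.all ρ (.ex σ a)) (.ex (.arr ρ σ) (.all ρ a))) :=
  .imp (.all (.ex A)) (.ex (.all (A.subst (choiceSub Γ ρ σ))))

/-- The instance of the double-negation shift for `A(x)`, with `x` of type `ρ`:
`∀ x ¬¬ A(x) → ¬¬ ∀ x A(x)`. -/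
def dnsFm {Γ : Ctx} {ρ : Ty} {a : Form} (A : Fm (ρ :: Γ) a) :
    Fm Γ (.imp (.all ρ a.neg.neg) (Form.all ρ a).neg.neg) :=
  .imp (.all A.neg.neg) (Fm.all A).neg.neg

/-! ### Natural deduction -/

/-- Lists of open assumptions with free variables in `Γ`. -/
inductive Hyps (Γ : Ctx) : List Form → Type
  | nil : Hyps Γ []
  | cons {a : Form} {l : List Form} : Fm Γ a → Hyps Γ l → Hyps Γ (a :: l)

def Hyps.get {Γ : Ctx} : {l : List Form} → Hyps Γ l → {a : Form} → Var l a → Fm Γ a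
  | _, .cons A _, _, .zero => A
  | _, .cons _ Δ, _, .succ i => Δ.get i

/-- Weakening of all assumptions by a fresh variable. -/
def Hyps.wk {Γ : Ctx} (τ : Ty) : {l : List Form} → Hyps Γ l → Hyps (τ :: Γ) l
  | _, .nil => .nil
  | _, .cons A Δ => .cons (A.wk τ) (Δ.wk τ)

/-- An extension of higher-type intuitionistic arithmetic: whether it has the law of excluded
middle, and at which types it has the axiom of choice and the double-negation shift. -/
structure Theory where
  lem : Prop
  ac : Ty → Ty → Prop
  dns : Ty → Prop

/-- Natural deduction derivations from open assumptions in the theory `S`: the rules of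
intuitionistic many-sorted predicate logic, equality at type `0`, conversion of terms, the Peano
axioms with full induction, and the additional schemata of `S`. -/
inductive Deriv (S : Theory) :
    {Γ : Ctx} → {l : List Form} → Hyps Γ l → {a : Form} → Fm Γ a → Type
  | hyp {Γ : Ctx} {l : List Form} {Δ : Hyps Γ l} {a : Form} (i : Var l a) : Deriv S Δ (Δ.get i)
  | andI {Γ : Ctx} {l : List Form} {Δ : Hyps Γ l} {a b : Form} {A : Fm Γ a} {B : Fm Γ b} :
      Deriv S Δ A → Deriv S Δ B → Deriv S Δ (.and A B)
  | andE1 {Γ : Ctx} {l : List Form} {Δ : Hyps Γ l} {a b : Form} {A : Fm Γ a} {B : Fm Γ b} :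
      Deriv S Δ (.and A B) → Deriv S Δ A
  | andE2 {Γ : Ctx} {l : List Form} {Δ : Hyps Γ l} {a b : Form} {A : Fm Γ a} {B : Fm Γ b} :
      Deriv S Δ (.and A B) → Deriv S Δ B
  | orI1 {Γ : Ctx} {l : List Form} {Δ : Hyps Γ l} {a b : Form} {A : Fm Γ a} {B : Fm Γ b} :
      Deriv S Δ A → Deriv S Δ (.or A B)
  | orI2 {Γ : Ctx} {l : List Form} {Δ : Hyps Γ l} {a b : Form} {A : Fm Γ a} {B : Fm Γ b} :
      Deriv S Δ B → Deriv S Δ (.or A B)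
  | orE {Γ : Ctx} {l : List Form} {Δ : Hyps Γ l} {a b c : Form} {A : Fm Γ a} {B : Fm Γ b}
      {C : Fm Γ c} :
      Deriv S Δ (.or A B) → Deriv S (.cons A Δ) C → Deriv S (.cons B Δ) C → Deriv S Δ C
  | impI {Γ : Ctx} {l : List Form} {Δ : Hyps Γ l} {a b : Form} {A : Fm Γ a} {B : Fm Γ b} :
      Deriv S (.cons A Δ) B → Deriv S Δ (.imp A B)
  | impE {Γ : Ctx} {l : List Form} {Δ : Hyps Γ l} {a b : Form} {A : Fm Γ a} {B : Fm Γ b} :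
      Deriv S Δ (.imp A B) → Deriv S Δ A → Deriv S Δ B
  | allI {Γ : Ctx} {l : List Form} {Δ : Hyps Γ l} {σ : Ty} {a : Form} {A : Fm (σ :: Γ) a} :
      Deriv S (Δ.wk σ) A → Deriv S Δ (.all A)
  | allE {Γ : Ctx} {l : List Form} {Δ : Hyps Γ l} {σ : Ty} {a : Form} {A : Fm (σ :: Γ) a}
      (t : Term Γ σ) : Deriv S Δ (.all A) → Deriv S Δ (A.inst t)
  | exI {Γ : Ctx} {l : List Form} {Δ : Hyps Γ l} {σ : Ty} {a : Form} {A : Fm (σ :: Γ) a}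
      (t : Term Γ σ) : Deriv S Δ (A.inst t) → Deriv S Δ (.ex A)
  | exE {Γ : Ctx} {l : List Form} {Δ : Hyps Γ l} {σ : Ty} {a c : Form} {A : Fm (σ :: Γ) a}
      {C : Fm Γ c} :
      Deriv S Δ (.ex A) → Deriv S (.cons A (Δ.wk σ)) (C.wk σ) → Deriv S Δ C
  | botE {Γ : Ctx} {l : List Form} {Δ : Hyps Γ l} {a : Form} {A : Fm Γ a} :
      Deriv S Δ .bot → Deriv S Δ A
  | eqRefl {Γ : Ctx} {l : List Form} {Δ : Hyps Γ l} (t : Term Γ .nat) : Deriv S Δ (.eq t t)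
  | eqSubst {Γ : Ctx} {l : List Form} {Δ : Hyps Γ l} {a : Form} (A : Fm (.nat :: Γ) a)
      {t u : Term Γ .nat} :
      Deriv S Δ (.eq t u) → Deriv S Δ (A.inst t) → Deriv S Δ (A.inst u)
  | conv {Γ : Ctx} {l : List Form} {Δ : Hyps Γ l} {σ : Ty} {a : Form} (A : Fm (σ :: Γ) a)
      {t u : Term Γ σ} : Conv t u → Deriv S Δ (A.inst t) → Deriv S Δ (A.inst u)
  | succNeZero {Γ : Ctx} {l : List Form} {Δ : Hyps Γ l} {t : Term Γ .nat} :
      Deriv S Δ (.eq (.succ t) .zero) → Deriv S Δ .bot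
  | succInj {Γ : Ctx} {l : List Form} {Δ : Hyps Γ l} {t u : Term Γ .nat} :
      Deriv S Δ (.eq (.succ t) (.succ u)) → Deriv S Δ (.eq t u)
  | ind {Γ : Ctx} {l : List Form} {Δ : Hyps Γ l} {a : Form} {A : Fm (.nat :: Γ) a} :
      Deriv S Δ (A.inst .zero) → Deriv S Δ (.all (.imp A A.step)) → Deriv S Δ (.all A)
  | lem {Γ : Ctx} {l : List Form} {Δ : Hyps Γ l} {a : Form} (h : S.lem) (A : Fm Γ a) :
      Deriv S Δ (.or A A.neg)
  | ac {Γ : Ctx} {l : List Form} {Δ : Hyps Γ l} {ρ σ : Ty} {a : Form} (h : S.ac ρ σ)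
      (A : Fm (σ :: ρ :: Γ) a) : Deriv S Δ (acFm A)
  | dns {Γ : Ctx} {l : List Form} {Δ : Hyps Γ l} {ρ : Ty} {a : Form} (h : S.dns ρ)
      (A : Fm (ρ :: Γ) a) : Deriv S Δ (dnsFm A)

/-- A proof of `A` in `S`: a derivation without open assumptions. -/
abbrev Proof (S : Theory) {Γ : Ctx} {a : Form} (A : Fm Γ a) : Type := Deriv S Hyps.nil A

/-- The theory `S` proves `A`. -/
def Provable (S : Theory) {Γ : Ctx} {a : Form} (A : Fm Γ a) : Prop := Nonempty (Proof S A)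

/-- `PA^ω + AC^ω`. -/
def PA_ACω : Theory where
  lem := True
  ac _ _ := True
  dns _ := False

/-- `HA^ω + AC^ω + DNS^ω`. -/
def HA_ACω_DNSω : Theory where
  lem := False
  ac _ _ := True
  dns _ := True

/-- Classical Analysis, `PA^ω + AC^0`: choice over type `0`, with values of any type. -/
def PA_AC0 : Theory where
  lem := True
  ac ρ _ := ρ = .nat
  dns _ := False

/-- `HA^ω + AC^0 + DNS^0`. -/
def HA_AC0_DNS0 : Theory where
  lem := False
  ac ρ _ := ρ = .nat
  dns ρ := ρ = .nat

/-! ### Modified realizability -/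

/-- The type of the realizers of a formula, determined by its logical form. -/
@[reducible] def Form.rty : Form → Ty
  | .prime => .unit
  | .and a b => .prod a.rty b.rty
  | .or a b => .prod (.prod a.rty b.rty) .nat
  | .imp a b => .arr a.rty b.rty
  | .all σ a => .arr σ a.rty
  | .ex σ a => .prod a.rty σ

/-- The logical form of the formula `t mr A`. -/
@[reducible] def Form.mr : Form → Form
  | .prime => .prime
  | .and a b => .and a.mr b.mr
  | .or a b => .and (.imp .prime a.mr) (.imp (Form.neg .prime) b.mr)
  | .imp a b => .all a.rty (.imp a.mr b.mr)
  | .all σ a => .all σ a.mr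
  | .ex _ a => a.mr

/-- The formula `t mr A`: the term `t` interprets `A` by modified realizability. -/
def mr : {a : Form} → {Γ : Ctx} → Term Γ a.rty → Fm Γ a → Fm Γ a.mr
  | .prime, _, _, P => P
  | .and a b, _, t, .and A B => .and (mr (a := a) (.fst t) A) (mr (a := b) (.snd t) B)
  | .or a b, _, t, .or A B =>
      .and (.imp (.eq (.snd t) .zero) (mr (a := a) (.fst (.fst t)) A))
        (.imp (Fm.neg (.eq (.snd t) .zero)) (mr (a := b) (.snd (.fst t)) B))
  | .imp a b, _, t, .imp A B =>
      .all (.imp (mr (a := a) (.var .zero) (A.wk _))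
        (mr (a := b) (.app (t.wk _) (.var .zero)) (B.wk _)))
  | .all _ a, _, t, .all A => .all (mr (a := a) (.app (t.wk _) (.var .zero)) A)
  | .ex _ a, _, t, .ex A => mr (a := a) (.fst t) (A.inst (.snd t))

/-! ### Program extraction -/

/-- Realizers, with free variables in `Γ`, for a list of open assumptions. -/
abbrev Realizers (Γ : Ctx) (l : List Form) : Type := ∀ a : Form, Var l a → Term Γ a.rty

def Realizers.nil {Γ : Ctx} : Realizers Γ [] := fun _ i => nomatch i

def Realizers.cons {Γ : Ctx} {l : List Form} {a : Form} (t : Term Γ a.rty) (e : Realizers Γ l) :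
    Realizers Γ (a :: l)
  | _, .zero => t
  | _, .succ i => e _ i

def Realizers.wk {Γ : Ctx} {l : List Form} (e : Realizers Γ l) (τ : Ty) :
    Realizers (τ :: Γ) l := fun _ i => (e _ i).wk τ

/-- The term extracted by modified realizability from a derivation without excluded middle, given
values `r` of the free variables and realizers `e` of the open assumptions. -/
def Deriv.extractAux {S : Theory} (hS : ¬ S.lem) {Γ : Ctx} {l : List Form} {Δ : Hyps Γ l}
    {a : Form} {A : Fm Γ a} :
    Deriv S Δ A → {Γ' : Ctx} → Sub Γ Γ' → Realizers Γ' l → Term Γ' a.rty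
  | .hyp i, _, _, e => e _ i
  | .andI p q, _, r, e => .pair (p.extractAux hS r e) (q.extractAux hS r e)
  | .andE1 p, _, r, e => .fst (p.extractAux hS r e)
  | .andE2 p, _, r, e => .snd (p.extractAux hS r e)
  | .orI1 p, _, r, e => .pair (.pair (p.extractAux hS r e) (.dflt _)) .zero
  | .orI2 p, _, r, e => .pair (.pair (.dflt _) (p.extractAux hS r e)) (.succ .zero)
  | .orE p q q', _, r, e =>
      .cond (.snd (p.extractAux hS r e))
        (q.extractAux hS r (e.cons (.fst (.fst (p.extractAux hS r e)))))
        (q'.extractAux hS r (e.cons (.snd (.fst (p.extractAux hS r e)))))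
  | .impI p, _, r, e => .lam (p.extractAux hS (r.wk _) ((e.wk _).cons (.var .zero)))
  | .impE p q, _, r, e => .app (p.extractAux hS r e) (q.extractAux hS r e)
  | .allI p, _, r, e => .lam (p.extractAux hS (r.lift _) (e.wk _))
  | .allE t p, _, r, e => .app (p.extractAux hS r e) (t.subst r)
  | .exI t p, _, r, e => .pair (p.extractAux hS r e) (t.subst r)
  | .exE p q, _, r, e =>
      q.extractAux hS (Sub.cons (.snd (p.extractAux hS r e)) r)
        (e.cons (.fst (p.extractAux hS r e)))
  | .botE _, _, _, _ => .dflt _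
  | .eqRefl _, _, _, _ => .star
  | .eqSubst _ _ q, _, r, e => q.extractAux hS r e
  | .conv _ _ q, _, r, e => q.extractAux hS r e
  | .succNeZero _, _, _, _ => .star
  | .succInj _, _, _, _ => .star
  | .ind p q, _, r, e =>
      .lam (.primrec ((p.extractAux hS r e).wk _) ((q.extractAux hS r e).wk _) (.var .zero))
  | .lem h _, _, _, _ => absurd h hS
  | .ac _ _, _, _, _ =>
      .lam (.pair (.lam (.fst (.app (.var (.succ .zero)) (.var .zero))))
        (.lam (.snd (.app (.var (.succ .zero)) (.var .zero)))))
  | .dns _ _, _, _, _ => .dflt _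

/-- The term extracted by modified realizability from a proof without excluded middle; its free
variables are among those of the proof. -/
def Deriv.extract {S : Theory} (hS : ¬ S.lem) {Γ : Ctx} {a : Form} {A : Fm Γ a}
    (d : Proof S A) : Term Γ a.rty :=
  d.extractAux hS (Sub.id Γ) Realizers.nil

theorem not_lem_HA_ACω_DNSω : ¬ HA_ACω_DNSω.lem := fun h => h

theorem not_lem_HA_AC0_DNS0 : ¬ HA_AC0_DNS0.lem := fun h => h

end HAOmega

/-! The statement has two independent halves: removing excluded middle, and soundness of
realizability for what is left.

With DNS at all types, no translation of formulas is needed. Double negation passes through every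
rule of natural deduction, ∀-introduction being the rule that costs a shift; ¬¬(A ∨ ¬A) is
intuitionistic, and AC is available in both theories. This is `Entails.nn_of_deriv`. With DNS only
at type 0 it breaks down, since a proof of an arithmetical formula may generalize over variables of
higher type. The Gödel–Gentzen translation leaves ∀ alone, so there the shift serves only to
interpret AC: ∀x¬¬∃y gives ¬¬∀x∃y, hence ¬¬∃f∀x (`Entails.nt_of_deriv`). For arithmetical A, the
shift at type 0 then leads from the translation of A back to ¬¬A (`Entails.nt_of_arithmetical`).

In the soundness proof (`Entails.mr_extractAux`) the remarkable case is DNS. A realizer of a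
negation carries no information: it exists just when the negated formula has no realizer. A realizer
of ∀x¬¬A(x) therefore yields ∀x¬¬∃y(y mr A(x)). DNS moves the double negation outside, and AC turns
∀x∃y(y mr A(x)) into a realizer of ∀xA(x), so ¬∀xA(x) cannot be realized (`Entails.bot_of_mr_dns`).
DNS is thus realized by means of DNS and AC themselves; AC is realized by projections alone. -/

namespace HAOmega

/-! ### The calculus of substitutions -/

/-- The substitution that adds a fresh variable. -/
def Sub.shift {Γ : Ctx} (τ : Ty) : Sub Γ (τ :: Γ) := fun _ v => .var (.succ v)

/-- Composition of substitutions, in diagrammatic order. -/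
def Sub.comp {Γ Γ' Γ'' : Ctx} (r : Sub Γ Γ') (s : Sub Γ' Γ'') : Sub Γ Γ'' :=
  fun _ v => (r _ v).subst s

/-- A renaming, seen as a substitution. -/
def Ren.toSub {Γ Γ' : Ctx} (r : Ren Γ Γ') : Sub Γ Γ' := fun _ v => .var (r _ v)

theorem Sub.lift_toSub {Γ Γ' : Ctx} (r : Ren Γ Γ') (τ : Ty) :
    r.toSub.lift τ = (r.lift τ).toSub := by
  funext σ v
  cases v <;> rfl

theorem Term.rename_eq_subst {Γ Γ' : Ctx} {σ : Ty} (t : Term Γ σ) (r : Ren Γ Γ') :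
    t.rename r = t.subst r.toSub := by
  induction t generalizing Γ' with
  | lam t ih => simp only [Term.rename, Term.subst, Sub.lift_toSub, ih]
  | _ => simp only [Term.rename, Term.subst, Ren.toSub, *]

theorem Term.wk_eq {Γ : Ctx} {σ : Ty} (τ : Ty) (t : Term Γ σ) :
    t.wk τ = t.subst (Sub.shift τ) :=
  t.rename_eq_subst _

theorem Sub.wk_id (Γ : Ctx) (τ : Ty) : (Sub.id Γ).wk τ = Sub.shift τ := rfl

theorem Sub.wk_eq {Γ Γ' : Ctx} (r : Sub Γ Γ') (τ : Ty) : r.wk τ = r.comp (Sub.shift τ) := by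
  funext σ v
  exact (r σ v).wk_eq τ

theorem Sub.lift_eq {Γ Γ' : Ctx} (r : Sub Γ Γ') (τ : Ty) :
    r.lift τ = Sub.cons (.var .zero) (r.comp (Sub.shift τ)) := by
  rw [Sub.lift, Sub.wk_eq]

theorem Sub.lift_id (Γ : Ctx) (τ : Ty) : (Sub.id Γ).lift τ = Sub.id (τ :: Γ) := by
  funext σ v
  cases v <;> rfl

theorem Term.subst_id {Γ : Ctx} {σ : Ty} (t : Term Γ σ) : t.subst (Sub.id Γ) = t := by
  induction t with
  | lam t ih => simp only [Term.subst, Sub.lift_id, ih]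
  | _ => simp only [Term.subst, Sub.id, *]

/-- Composition of substitutions is reached in two stages: lifting a substitution weakens its values
by a renaming, so the mixed laws for renamings and substitutions must come first. -/
theorem Term.subst_rename {Γ Γ' Γ'' : Ctx} {σ : Ty} (t : Term Γ σ) (r : Ren Γ Γ')
    (s : Sub Γ' Γ'') : (t.rename r).subst s = t.subst (fun _ v => s _ (r _ v)) := by
  induction t generalizing Γ' Γ'' with
  | lam t ih =>
    simp only [Term.rename, Term.subst, ih]
    congr 2
    funext σ v
    cases v <;> rfl
  | _ => simp only [Term.rename, Term.subst, *]

theorem Term.rename_subst {Γ Γ' Γ'' : Ctx} {σ : Ty} (t : Term Γ σ) (r : Sub Γ Γ')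
    (s : Ren Γ' Γ'') : (t.subst r).rename s = t.subst (fun _ v => (r _ v).rename s) := by
  induction t generalizing Γ' Γ'' with
  | lam t ih =>
    simp only [Term.rename, Term.subst, ih]
    congr 2
    funext σ v
    cases v with
    | zero => rfl
    | succ v =>
      -- Two renamings compose once the outer one is read as a substitution.
      change ((r σ v).rename _).rename _ = ((r σ v).rename _).rename _
      rw [Term.rename_eq_subst _ (Ren.lift _ _), Term.subst_rename,
        Term.rename_eq_subst _ (Ren.wk _), Term.subst_rename]
      rfl
  | _ => simp only [Term.rename, Term.subst, *]

theorem Sub.lift_comp {Γ Γ' Γ'' : Ctx} (r : Sub Γ Γ') (s : Sub Γ' Γ'') (τ : Ty) :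
    (r.lift τ).comp (s.lift τ) = (r.comp s).lift τ := by
  funext σ v
  cases v with
  | zero => rfl
  | succ v =>
    change ((r σ v).rename _).subst _ = ((r σ v).subst s).rename _
    rw [Term.subst_rename, Term.rename_subst]
    rfl

theorem Term.subst_subst {Γ Γ' Γ'' : Ctx} {σ : Ty} (t : Term Γ σ) (r : Sub Γ Γ')
    (s : Sub Γ' Γ'') : (t.subst r).subst s = t.subst (r.comp s) := by
  induction t generalizing Γ' Γ'' with
  | lam t ih => simp only [Term.subst, ih, Sub.lift_comp]
  | _ => simp only [Term.subst, Sub.comp, *]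

theorem Sub.comp_assoc {Γ Γ' Γ'' Γ₃ : Ctx} (r : Sub Γ Γ') (s : Sub Γ' Γ'') (q : Sub Γ'' Γ₃) :
    (r.comp s).comp q = r.comp (s.comp q) := by
  funext σ v
  exact Term.subst_subst _ _ _

theorem Sub.cons_comp {Γ Γ' Γ'' : Ctx} {τ : Ty} (t : Term Γ' τ) (r : Sub Γ Γ')
    (s : Sub Γ' Γ'') : (Sub.cons t r).comp s = Sub.cons (t.subst s) (r.comp s) := by
  funext σ v
  cases v <;> rfl

theorem Sub.shift_comp_cons {Γ Γ' : Ctx} {τ : Ty} (t : Term Γ' τ) (r : Sub Γ Γ') :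
    (Sub.shift τ).comp (Sub.cons t r) = r := rfl

theorem Sub.id_comp {Γ Γ' : Ctx} (r : Sub Γ Γ') : (Sub.id Γ).comp r = r := rfl

theorem Sub.comp_id {Γ Γ' : Ctx} (r : Sub Γ Γ') : r.comp (Sub.id Γ') = r := by
  funext σ v
  exact Term.subst_id _

theorem Sub.cons_shift (Γ : Ctx) (τ : Ty) :
    Sub.cons (.var .zero) (Sub.shift τ) = Sub.id (τ :: Γ) := by
  funext σ v
  cases v <;> rfl

theorem Sub.cons_zero {Γ Γ' : Ctx} {τ : Ty} (t : Term Γ' τ) (r : Sub Γ Γ') :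
    Sub.cons t r τ .zero = t := rfl

theorem Sub.cons_succ {Γ Γ' : Ctx} {σ τ : Ty} (t : Term Γ' τ) (r : Sub Γ Γ') (v : Var Γ σ) :
    Sub.cons t r σ (.succ v) = r σ v := rfl

theorem Sub.shift_apply {Γ : Ctx} {σ : Ty} (τ : Ty) (v : Var Γ σ) :
    Sub.shift τ σ v = .var (.succ v) := rfl

theorem Term.inst_eq {Γ : Ctx} {σ τ : Ty} (t : Term (τ :: Γ) σ) (u : Term Γ τ) :
    t.inst u = t.subst (Sub.cons u (Sub.id Γ)) := rfl

/-! ### Substitution in conversions, formulas and realizability -/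

theorem Conv.subst {Γ : Ctx} {σ : Ty} {t u : Term Γ σ} (h : Conv t u) {Γ' : Ctx}
    (r : Sub Γ Γ') : Conv (t.subst r) (u.subst r) := by
  induction h generalizing Γ' with
  | refl t => exact .refl _
  | symm _ ih => exact .symm (ih r)
  | trans _ _ ih ih' => exact .trans (ih r) (ih' r)
  | lam _ ih => exact .lam (ih _)
  | app _ _ ih ih' => exact .app (ih r) (ih' r)
  | pair _ _ ih ih' => exact .pair (ih r) (ih' r)
  | fst _ ih => exact .fst (ih r)
  | snd _ ih => exact .snd (ih r)
  | succ _ ih => exact .succ (ih r)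
  | primrec _ _ _ ih ih' ih'' => exact .primrec (ih r) (ih' r) (ih'' r)
  | beta t u =>
    -- Contracting before or after the substitution gives `t` under `Sub.cons (u.subst r) r` in both
    -- cases.
    have h := Conv.beta (t.subst (r.lift _)) (u.subst r)
    simpa only [Term.subst, Term.inst_eq, Term.subst_subst, Sub.lift_eq, Sub.cons_comp, Sub.comp_assoc,
      Sub.shift_comp_cons, Sub.comp_id, Sub.id_comp, Sub.cons_zero] using h
  | fst_pair t u => exact .fst_pair _ _
  | snd_pair t u => exact .snd_pair _ _
  | primrec_zero t u => exact .primrec_zero _ _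
  | primrec_succ t u n => exact .primrec_succ _ _ _

theorem Fm.subst_id {Γ : Ctx} {a : Form} (A : Fm Γ a) : A.subst (Sub.id Γ) = A := by
  induction A with
  | _ => simp only [Fm.subst, Term.subst_id, Sub.lift_id, *]

theorem Fm.subst_subst {Γ Γ' Γ'' : Ctx} {a : Form} (A : Fm Γ a) (r : Sub Γ Γ')
    (s : Sub Γ' Γ'') : (A.subst r).subst s = A.subst (r.comp s) := by
  induction A generalizing Γ' Γ'' with
  | _ => simp only [Fm.subst, Term.subst_subst, Sub.lift_comp, *]

theorem Fm.inst_eq {Γ : Ctx} {a : Form} {τ : Ty} (A : Fm (τ :: Γ) a) (t : Term Γ τ) :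
    A.inst t = A.subst (Sub.cons t (Sub.id Γ)) := rfl

theorem Fm.wk_eq {Γ : Ctx} {a : Form} (τ : Ty) (A : Fm Γ a) :
    A.wk τ = A.subst (Sub.shift τ) := rfl

theorem Fm.step_eq {Γ : Ctx} {a : Form} (A : Fm (.nat :: Γ) a) :
    A.step = A.subst (Sub.cons (.succ (.var .zero)) (Sub.shift .nat)) := rfl

theorem choiceSub_eq (Γ : Ctx) (ρ σ : Ty) :
    choiceSub Γ ρ σ = Sub.cons (.app (.var (.succ .zero)) (.var .zero))
      (Sub.cons (.var .zero) ((Sub.shift (.arr ρ σ)).comp (Sub.shift ρ))) := by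
  rw [choiceSub, Sub.lift_eq, Sub.wk_id]

/-- `t mr A` commutes with substitution. -/
theorem mr_subst {a : Form} {Γ Γ' : Ctx} (t : Term Γ a.rty) (A : Fm Γ a) (r : Sub Γ Γ') :
    (mr t A).subst r = mr (t.subst r) (A.subst r) := by
  -- The induction is on the logical form: the ∃ clause of `mr` passes to an instance of the body,
  -- which is not a subformula but has a smaller form.
  induction a generalizing Γ Γ' with
  | prime => cases A <;> rfl
  | and a b iha ihb =>
    cases A
    simp only [mr, Fm.subst, Term.subst, iha, ihb]
  | or a b iha ihb =>
    cases A
    simp only [mr, Fm.subst, Term.subst, iha, ihb]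
  | imp a b iha ihb =>
    cases A
    simp only [mr, Fm.subst, Term.subst, iha, ihb, Fm.wk_eq, Term.wk_eq, Fm.subst_subst,
      Term.subst_subst, Sub.lift_eq, Sub.shift_comp_cons, Sub.cons_zero]
  | all σ a ih =>
    cases A
    simp only [mr, Fm.subst, Term.subst, ih, Term.wk_eq,
      Term.subst_subst, Sub.lift_eq, Sub.shift_comp_cons, Sub.cons_zero]
  | ex σ a ih =>
    cases A
    simp only [mr, Fm.subst, Term.subst, ih, Fm.inst_eq, Fm.subst_subst, Sub.lift_eq,
      Sub.cons_comp, Sub.comp_assoc, Sub.shift_comp_cons, Sub.comp_id, Sub.id_comp,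
      Sub.cons_zero]

theorem Fm.subst_inst {Γ Γ' : Ctx} {a : Form} {τ : Ty} (A : Fm (τ :: Γ) a) (t : Term Γ τ)
    (r : Sub Γ Γ') : (A.inst t).subst r = (A.subst (r.lift τ)).inst (t.subst r) := by
  simp only [Fm.inst_eq, Fm.subst_subst, Sub.lift_eq, Sub.cons_comp, Sub.comp_assoc,
    Sub.shift_comp_cons, Sub.comp_id, Sub.id_comp, Term.subst, Sub.cons_zero]

theorem Fm.inst_subst_lift {Γ Γ' : Ctx} {a : Form} {τ : Ty} (A : Fm (τ :: Γ) a)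
    (t : Term Γ' τ) (r : Sub Γ Γ') : (A.subst (r.lift τ)).inst t = A.subst (Sub.cons t r) := by
  simp only [Fm.inst_eq, Fm.subst_subst, Sub.lift_eq, Sub.cons_comp, Sub.comp_assoc,
    Sub.shift_comp_cons, Sub.comp_id, Term.subst, Sub.cons_zero]

theorem Fm.subst_wk {Γ Γ' : Ctx} {a : Form} (A : Fm Γ a) (τ : Ty) (r : Sub Γ Γ') :
    (A.wk τ).subst (r.lift τ) = (A.subst r).wk τ := by
  simp only [Fm.wk_eq, Fm.subst_subst, Sub.lift_eq, Sub.shift_comp_cons]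

theorem Fm.subst_sub_wk {Γ Γ' : Ctx} {a : Form} (A : Fm Γ a) (τ : Ty) (r : Sub Γ Γ') :
    A.subst (r.wk τ) = (A.subst r).wk τ := by
  simp only [Fm.wk_eq, Fm.subst_subst, Sub.wk_eq]

theorem Fm.wk_subst_cons {Γ Γ' : Ctx} {a : Form} {τ : Ty} (A : Fm Γ a) (t : Term Γ' τ)
    (r : Sub Γ Γ') : (A.wk τ).subst (Sub.cons t r) = A.subst r := by
  simp only [Fm.wk_eq, Fm.subst_subst, Sub.shift_comp_cons]

theorem Term.wk_inst {Γ : Ctx} {σ τ : Ty} (t : Term Γ σ) (u : Term Γ τ) :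
    (t.wk τ).inst u = t := by
  rw [Term.inst, Term.wk_eq, Term.subst_subst, Sub.shift_comp_cons, Term.subst_id]

/-- Instantiation, by the last variable itself, of a formula weakened below its last variable. -/
theorem Fm.inst_var_zero {Γ : Ctx} {a : Form} {τ : Ty} (A : Fm (τ :: Γ) a) :
    (A.subst ((Sub.shift τ).lift τ)).inst (.var .zero) = A := by
  rw [Fm.inst_subst_lift, Sub.cons_shift, Fm.subst_id]

theorem Fm.subst_step {Γ Γ' : Ctx} {a : Form} (A : Fm (.nat :: Γ) a) (r : Sub Γ Γ') :
    A.step.subst (r.lift .nat) = (A.subst (r.lift .nat)).step := by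
  simp only [Fm.step_eq, Fm.subst_subst, Sub.lift_eq, Sub.cons_comp, Sub.comp_assoc,
    Sub.shift_comp_cons, Term.subst, Sub.cons_zero]

theorem subst_acFm {Γ Γ' : Ctx} {ρ σ : Ty} {a : Form} (A : Fm (σ :: ρ :: Γ) a)
    (r : Sub Γ Γ') : (acFm A).subst r = acFm (A.subst ((r.lift ρ).lift σ)) := by
  simp only [acFm, choiceSub_eq, Fm.subst, Fm.subst_subst, Sub.lift_eq, Sub.cons_comp,
    Sub.comp_assoc, Sub.shift_comp_cons, Term.subst, Sub.cons_zero, Sub.cons_succ,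
    Sub.shift_apply]

/-! ### Derivability -/

theorem Hyps.get_wk {Γ : Ctx} (τ : Ty) {l : List Form} (Δ : Hyps Γ l) {a : Form}
    (i : Var l a) : (Δ.wk τ).get i = (Δ.get i).wk τ := by
  induction Δ with
  | nil => cases i
  | cons A Δ ih =>
    cases i with
    | zero => rfl
    | succ i => exact ih i

/-- `A` is derivable in `S` from the open assumptions `Δ`. -/
def Entails (S : Theory) {Γ : Ctx} {l : List Form} (Δ : Hyps Γ l) {a : Form} (A : Fm Γ a) :
    Prop :=
  Nonempty (Deriv S Δ A)

/-- Every assumption in `Δ` becomes, under the substitution `r`, an assumption in `Δ'`. -/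
def Hyps.Maps {Γ Γ' : Ctx} {l l' : List Form} (Δ : Hyps Γ l) (r : Sub Γ Γ') (Δ' : Hyps Γ' l') :
    Prop :=
  ∀ (a : Form) (i : Var l a), ∃ j : Var l' a, Δ'.get j = (Δ.get i).subst r

theorem Hyps.Maps.cons {Γ Γ' : Ctx} {l l' : List Form} {Δ : Hyps Γ l} {r : Sub Γ Γ'}
    {Δ' : Hyps Γ' l'} (h : Δ.Maps r Δ') {a : Form} (A : Fm Γ a) :
    (Hyps.cons A Δ).Maps r (Hyps.cons (A.subst r) Δ') := by
  intro b i
  cases i with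
  | zero => exact ⟨.zero, rfl⟩
  | succ i =>
    obtain ⟨j, hj⟩ := h _ i
    exact ⟨.succ j, hj⟩

theorem Hyps.Maps.wk {Γ Γ' : Ctx} {l l' : List Form} {Δ : Hyps Γ l} {r : Sub Γ Γ'}
    {Δ' : Hyps Γ' l'} (h : Δ.Maps r Δ') (τ : Ty) : (Δ.wk τ).Maps (r.lift τ) (Δ'.wk τ) := by
  intro b i
  obtain ⟨j, hj⟩ := h _ i
  exact ⟨j, by rw [Hyps.get_wk, Hyps.get_wk, hj, Fm.subst_wk]⟩

namespace Entails

variable {S : Theory} {Γ : Ctx} {l : List Form} {Δ : Hyps Γ l} {a b c : Form}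
  {A : Fm Γ a} {B : Fm Γ b} {C : Fm Γ c}

theorem hyp (i : Var l a) : Entails S Δ (Δ.get i) := ⟨.hyp i⟩

theorem cast {A' : Fm Γ a} (h : Entails S Δ A) (e : A = A') : Entails S Δ A' := e ▸ h

theorem hyp₀ : Entails S (.cons A Δ) A := hyp (Δ := .cons A Δ) .zero

theorem hyp₁ : Entails S (.cons B (.cons A Δ)) A :=
  hyp (Δ := .cons B (.cons A Δ)) (.succ .zero)

theorem andI (h : Entails S Δ A) (h' : Entails S Δ B) : Entails S Δ (.and A B) :=
  h.elim fun d => h'.elim fun d' => ⟨.andI d d'⟩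

theorem andE1 (h : Entails S Δ (.and A B)) : Entails S Δ A := h.elim fun d => ⟨.andE1 d⟩

theorem andE2 (h : Entails S Δ (.and A B)) : Entails S Δ B := h.elim fun d => ⟨.andE2 d⟩

theorem orI1 (h : Entails S Δ A) : Entails S Δ (.or A B) := h.elim fun d => ⟨.orI1 d⟩

theorem orI2 (h : Entails S Δ B) : Entails S Δ (.or A B) := h.elim fun d => ⟨.orI2 d⟩

theorem orE (h : Entails S Δ (.or A B)) (h₁ : Entails S (.cons A Δ) C)
    (h₂ : Entails S (.cons B Δ) C) : Entails S Δ C :=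
  h.elim fun d => h₁.elim fun d₁ => h₂.elim fun d₂ => ⟨.orE d d₁ d₂⟩

theorem impI (h : Entails S (.cons A Δ) B) : Entails S Δ (.imp A B) :=
  h.elim fun d => ⟨.impI d⟩

theorem impE (h : Entails S Δ (.imp A B)) (h' : Entails S Δ A) : Entails S Δ B :=
  h.elim fun d => h'.elim fun d' => ⟨.impE d d'⟩

theorem allI {σ : Ty} {A : Fm (σ :: Γ) a} (h : Entails S (Δ.wk σ) A) : Entails S Δ (.all A) :=
  h.elim fun d => ⟨.allI d⟩

theorem allE {σ : Ty} {A : Fm (σ :: Γ) a} (t : Term Γ σ) (h : Entails S Δ (.all A)) :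
    Entails S Δ (A.inst t) :=
  h.elim fun d => ⟨.allE t d⟩

theorem exI {σ : Ty} {A : Fm (σ :: Γ) a} (t : Term Γ σ) (h : Entails S Δ (A.inst t)) :
    Entails S Δ (.ex A) :=
  h.elim fun d => ⟨.exI t d⟩

theorem exE {σ : Ty} {A : Fm (σ :: Γ) a} (h : Entails S Δ (.ex A))
    (h' : Entails S (.cons A (Δ.wk σ)) (C.wk σ)) : Entails S Δ C :=
  h.elim fun d => h'.elim fun d' => ⟨.exE d d'⟩

theorem botE (h : Entails S Δ .bot) : Entails S Δ A := h.elim fun d => ⟨.botE d⟩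

theorem eqRefl (t : Term Γ .nat) : Entails S Δ (.eq t t) := ⟨.eqRefl t⟩

theorem eqSubst (A : Fm (.nat :: Γ) a) {t u : Term Γ .nat} (h : Entails S Δ (.eq t u))
    (h' : Entails S Δ (A.inst t)) : Entails S Δ (A.inst u) :=
  h.elim fun d => h'.elim fun d' => ⟨.eqSubst A d d'⟩

theorem conv {σ : Ty} (A : Fm (σ :: Γ) a) {t u : Term Γ σ} (e : Conv t u)
    (h : Entails S Δ (A.inst t)) : Entails S Δ (A.inst u) :=
  h.elim fun d => ⟨.conv A e d⟩

theorem succNeZero {t : Term Γ .nat} (h : Entails S Δ (.eq (.succ t) .zero)) :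
    Entails S Δ .bot :=
  h.elim fun d => ⟨.succNeZero d⟩

theorem succInj {t u : Term Γ .nat} (h : Entails S Δ (.eq (.succ t) (.succ u))) :
    Entails S Δ (.eq t u) :=
  h.elim fun d => ⟨.succInj d⟩

theorem ind {A : Fm (.nat :: Γ) a} (h : Entails S Δ (A.inst .zero))
    (h' : Entails S Δ (.all (.imp A A.step))) : Entails S Δ (.all A) :=
  h.elim fun d => h'.elim fun d' => ⟨.ind d d'⟩

theorem ac {ρ σ : Ty} (h : S.ac ρ σ) (A : Fm (σ :: ρ :: Γ) a) : Entails S Δ (acFm A) :=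
  ⟨.ac h A⟩

theorem dns {ρ : Ty} (h : S.dns ρ) (A : Fm (ρ :: Γ) a) : Entails S Δ (dnsFm A) := ⟨.dns h A⟩

/-- Derivability is closed under substitution for the free variables and under adding, permuting
and contracting assumptions. -/
theorem subst (h : Entails S Δ A) {Γ' : Ctx} {l' : List Form} {r : Sub Γ Γ'}
    {Δ' : Hyps Γ' l'} (hr : Δ.Maps r Δ') : Entails S Δ' (A.subst r) := by
  obtain ⟨d⟩ := h
  induction d generalizing Γ' l' with
  | hyp i =>
    obtain ⟨j, hj⟩ := hr _ i
    exact hj ▸ hyp j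
  | andI _ _ ih ih' => exact andI (ih hr) (ih' hr)
  | andE1 _ ih => exact andE1 (ih hr)
  | andE2 _ ih => exact andE2 (ih hr)
  | orI1 _ ih => exact orI1 (ih hr)
  | orI2 _ ih => exact orI2 (ih hr)
  | orE _ _ _ ih ih₁ ih₂ => exact orE (ih hr) (ih₁ (hr.cons _)) (ih₂ (hr.cons _))
  | impI _ ih => exact impI (ih (hr.cons _))
  | impE _ _ ih ih' => exact impE (ih hr) (ih' hr)
  | allI _ ih => exact allI (ih (hr.wk _))
  | allE t _ ih => exact (allE (t.subst r) (ih hr)).cast (Fm.subst_inst _ _ _).symm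
  | exI t _ ih => exact exI (t.subst r) ((ih hr).cast (Fm.subst_inst _ _ _))
  | exE _ _ ih ih' => exact exE (ih hr) ((ih' ((hr.wk _).cons _)).cast (Fm.subst_wk _ _ _))
  | botE _ ih => exact botE (ih hr)
  | eqRefl t => exact eqRefl _
  | eqSubst A _ _ ih ih' =>
    exact (eqSubst (A.subst (r.lift _)) (ih hr) ((ih' hr).cast (Fm.subst_inst _ _ _))).cast
      (Fm.subst_inst _ _ _).symm
  | conv A e _ ih =>
    exact (conv (A.subst (r.lift _)) (e.subst r) ((ih hr).cast (Fm.subst_inst _ _ _))).cast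
      (Fm.subst_inst _ _ _).symm
  | succNeZero _ ih => exact succNeZero (ih hr)
  | succInj _ ih => exact succInj (ih hr)
  | ind _ _ ih ih' =>
    refine ind ((ih hr).cast (Fm.subst_inst _ _ _)) ((ih' hr).cast ?_)
    simp only [Fm.subst, Fm.subst_step]
  | lem h A => exact ⟨.lem h _⟩
  | ac h A => exact (ac h _).cast (subst_acFm A r).symm
  | dns h A => exact dns h _

/-- Weakening by an assumption. -/
theorem weaken (h : Entails S Δ A) : Entails S (.cons B Δ) A :=
  (h.subst (r := Sub.id Γ) (Δ' := .cons B Δ) fun _ i => ⟨.succ i, (Fm.subst_id _).symm⟩).cast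
    (Fm.subst_id _)

/-- Weakening by an assumption below the last one. -/
theorem weaken₁ (h : Entails S (.cons B Δ) A) : Entails S (.cons B (.cons C Δ)) A := by
  refine (h.subst (r := Sub.id Γ) (Δ' := .cons B (.cons C Δ)) fun _ i => ?_).cast (Fm.subst_id _)
  cases i with
  | zero => exact ⟨.zero, (Fm.subst_id _).symm⟩
  | succ i => exact ⟨.succ (.succ i), (Fm.subst_id _).symm⟩

/-- Weakening by a fresh variable. -/
theorem wk (τ : Ty) (h : Entails S Δ A) : Entails S (Δ.wk τ) (A.wk τ) :=
  h.subst fun _ i => ⟨i, Hyps.get_wk τ Δ i⟩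

/-- Universal elimination by the last variable, in a weakened context. -/
theorem allE_wk {σ : Ty} {A : Fm (σ :: Γ) a} (h : Entails S Δ (.all A)) :
    Entails S (Δ.wk σ) A :=
  ((h.wk σ).allE (.var .zero)).cast A.inst_var_zero

end Entails

namespace Entails

variable {S : Theory} {Γ : Ctx} {l : List Form} {Δ : Hyps Γ l} {a b c : Form}
  {A : Fm Γ a} {B : Fm Γ b} {C : Fm Γ c}

theorem hyp₂ : Entails S (.cons C (.cons B (.cons A Δ))) A :=
  hyp (Δ := .cons C (.cons B (.cons A Δ))) (.succ (.succ .zero))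

/-- Introduction of an existential quantifier witnessed by the last variable. -/
theorem exI_wk {σ : Ty} {Θ : Hyps (σ :: Γ) l} {A : Fm (σ :: Γ) a} (h : Entails S Θ A) :
    Entails S Θ ((Fm.ex A).wk σ) :=
  exI (.var .zero) (h.cast A.inst_var_zero.symm)

/-- Elimination, by the last variable, of a weakened universal quantifier. -/
theorem wk_allE {σ : Ty} {Θ : Hyps (σ :: Γ) l} {A : Fm (σ :: Γ) a}
    (h : Entails S Θ ((Fm.all A).wk σ)) : Entails S Θ A :=
  (allE (.var .zero) h).cast A.inst_var_zero

/-! ### Double negation -/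

theorem nnI (h : Entails S Δ A) : Entails S Δ A.neg.neg :=
  impI (impE hyp₀ h.weaken)

/-- Double negation is a monad with unit `nnI`: while the goal is doubly negated, a doubly negated
premise may be used as if it were proved. -/
theorem nnBind (h : Entails S Δ A.neg.neg) (h' : Entails S (.cons A Δ) B.neg.neg) :
    Entails S Δ B.neg.neg :=
  impI (impE h.weaken (impI (impE h'.weaken₁ hyp₁)))

theorem nnMap (h : Entails S Δ A.neg.neg) (h' : Entails S (.cons A Δ) B) :
    Entails S Δ B.neg.neg :=
  nnBind h (nnI h')

theorem nnMap₂ (h : Entails S Δ A.neg.neg) (h' : Entails S Δ B.neg.neg)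
    (h'' : Entails S (.cons B (.cons A Δ)) C) : Entails S Δ C.neg.neg :=
  nnBind h (nnMap h'.weaken h'')

/-- From ¬(A → B) follows ¬B, because B gives A → B vacuously. Under A this contradicts ¬¬B, so A →
B holds by ex falso. -/
theorem nnImp (h : Entails S (.cons A Δ) B.neg.neg) : Entails S Δ (Fm.imp A B).neg.neg :=
  impI (impE hyp₀ (impI (botE (impE h.weaken₁ (impI (impE hyp₂ (impI hyp₁)))))))

/-- The shift in the form of an introduction rule; this is the counterpart of `nnImp` that
intuitionistic logic does not supply. -/
theorem nnAll {σ : Ty} (hσ : S.dns σ) {A : Fm (σ :: Γ) a}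
    (h : Entails S (Δ.wk σ) A.neg.neg) : Entails S Δ (Fm.all A).neg.neg :=
  impE (dns hσ A) (allI h)

theorem nnLem (A : Fm Γ a) : Entails S Δ (Fm.or A A.neg).neg.neg :=
  impI (impE hyp₀ (orI2 (impI (impE hyp₁ (orI1 hyp₀)))))

/-- With the double-negation shift at all types, the double negation of a classically derivable
formula is derivable without excluded middle. -/
theorem nn_of_deriv {T : Theory} (hac : ∀ ρ σ, T.ac ρ σ → S.ac ρ σ) (hdns : ∀ ρ, S.dns ρ)
    (d : Deriv T Δ A) : Entails S Δ A.neg.neg := by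
  -- Only conclusions acquire ¬¬; open assumptions stay as they are, and `nnImp` makes this
  -- sufficient when an assumption is discharged.
  induction d with
  | hyp i => exact nnI (hyp i)
  | andI _ _ ih ih' => exact nnMap₂ ih ih' (andI hyp₁ hyp₀)
  | andE1 _ ih => exact nnMap ih (andE1 hyp₀)
  | andE2 _ ih => exact nnMap ih (andE2 hyp₀)
  | orI1 _ ih => exact nnMap ih (orI1 hyp₀)
  | orI2 _ ih => exact nnMap ih (orI2 hyp₀)
  | orE _ _ _ ih ih₁ ih₂ => exact nnBind ih (orE hyp₀ ih₁.weaken₁ ih₂.weaken₁)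
  | impI _ ih => exact nnImp ih
  | impE _ _ ih ih' => exact nnMap₂ ih ih' (impE hyp₁ hyp₀)
  | allI _ ih => exact nnAll (hdns _) ih
  | allE t _ ih => exact nnMap ih (allE t hyp₀)
  | exI t _ ih => exact nnMap ih (exI t hyp₀)
  | exE _ _ ih ih' => exact nnBind ih (exE hyp₀ ih'.weaken₁)
  | botE _ ih => exact nnMap ih (botE hyp₀)
  | eqRefl t => exact nnI (eqRefl t)
  | eqSubst A _ _ ih ih' => exact nnMap₂ ih ih' (eqSubst A hyp₁ hyp₀)
  | conv A e _ ih => exact nnMap ih (conv A e hyp₀)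
  | succNeZero _ ih => exact nnMap ih (succNeZero hyp₀)
  | succInj _ ih => exact nnMap ih (succInj hyp₀)
  | ind _ _ ih ih' => exact nnMap₂ ih ih' (ind hyp₁ hyp₀)
  | lem _ A => exact nnLem A
  | ac h A => exact nnI (ac (hac _ _ h) A)
  | dns _ A => exact nnI (dns (hdns _) A)

end Entails

/-! ### The negative translation -/

/-- The logical form of the negative translation of a formula. -/
@[reducible] def Form.nt : Form → Form
  | .prime => Form.neg (Form.neg .prime)
  | .and a b => .and a.nt b.nt
  | .or a b => Form.neg (Form.neg (.or a.nt b.nt))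
  | .imp a b => .imp a.nt b.nt
  | .all σ a => .all σ a.nt
  | .ex σ a => Form.neg (Form.neg (.ex σ a.nt))

/-- The negative translation of Gödel and Gentzen: prime formulas, disjunctions and existential
quantifiers are doubly negated. -/
def Fm.nt {Γ : Ctx} {a : Form} : Fm Γ a → Fm Γ a.nt
  | .eq t u => (Fm.eq t u).neg.neg
  | .bot => Fm.bot.neg.neg
  | .and A B => .and A.nt B.nt
  | .or A B => (Fm.or A.nt B.nt).neg.neg
  | .imp A B => .imp A.nt B.nt
  | .all A => .all A.nt
  | .ex A => (Fm.ex A.nt).neg.neg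

theorem Fm.nt_subst {Γ Γ' : Ctx} {a : Form} (A : Fm Γ a) (r : Sub Γ Γ') :
    (A.subst r).nt = A.nt.subst r := by
  induction A generalizing Γ' with
  | _ => simp only [Fm.subst, Fm.nt, *]

namespace Entails

variable {S : Theory} {Γ : Ctx} {l : List Form} {Δ : Hyps Γ l} {a b c : Form}
  {A : Fm Γ a}

/-- Negative formulas are stable under double negation. -/
theorem nt_stable (h : Entails S Δ A.nt.neg.neg) : Entails S Δ A.nt := by
  induction A generalizing l with
  -- A formula that already begins with ¬¬ is stable because four negations collapse to two; the
  -- other cases pass stability on from the components.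
  | eq _ _ => exact nnBind h hyp₀
  | bot => exact nnBind h hyp₀
  | and _ _ ihA ihB => exact andI (ihA (nnMap h (andE1 hyp₀))) (ihB (nnMap h (andE2 hyp₀)))
  | or _ _ _ _ => exact nnBind h hyp₀
  | imp _ _ _ ihB => exact impI (ihB (nnMap h.weaken (impE hyp₀ hyp₁)))
  | all _ ih => exact allI (ih (nnMap (h.wk _) (wk_allE hyp₀)))
  | ex _ _ => exact nnBind h hyp₀

/-- Soundness of the negative translation: the translation of the axiom of choice follows from
the axiom of choice and the double-negation shift. -/
theorem nt_of_deriv {T : Theory} (hac : ∀ ρ σ, T.ac ρ σ → S.ac ρ σ)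
    (hdns : ∀ ρ σ, T.ac ρ σ → S.dns ρ) (hT : ∀ ρ, ¬ T.dns ρ) (d : Deriv T Δ A)
    {l' : List Form} {Δ' : Hyps Γ l'}
    (hΔ : ∀ (b : Form) (i : Var l b), Entails S Δ' (Δ.get i).nt) : Entails S Δ' A.nt := by
  -- The invariant on assumptions must survive a new assumption (`ext`) and a new eigenvariable
  -- (`wk'`).
  have ext : ∀ {Γ : Ctx} {l l' : List Form} {Δ : Hyps Γ l} {Δ' : Hyps Γ l'} {b : Form}
      (B : Fm Γ b), (∀ (c : Form) (i : Var l c), Entails S Δ' (Δ.get i).nt) →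
      ∀ (c : Form) (i : Var (b :: l) c),
        Entails S (.cons B.nt Δ') ((Hyps.cons B Δ).get i).nt := by
    intro Γ l l' Δ Δ' b B h c i
    cases i with
    | zero => exact hyp₀
    | succ i => exact (h c i).weaken
  have wk' : ∀ {Γ : Ctx} {l l' : List Form} {Δ : Hyps Γ l} {Δ' : Hyps Γ l'} (σ : Ty),
      (∀ (c : Form) (i : Var l c), Entails S Δ' (Δ.get i).nt) →
      ∀ (c : Form) (i : Var l c), Entails S (Δ'.wk σ) ((Δ.wk σ).get i).nt := by
    intro Γ l l' Δ Δ' σ h c i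
    rw [Hyps.get_wk, Fm.wk, Fm.nt_subst]
    exact (h c i).wk σ
  induction d generalizing l' with
  | hyp i => exact hΔ _ i
  | andI _ _ ih ih' => exact andI (ih hΔ) (ih' hΔ)
  | andE1 _ ih => exact andE1 (ih hΔ)
  | andE2 _ ih => exact andE2 (ih hΔ)
  | orI1 _ ih => exact nnI (orI1 (ih hΔ))
  | orI2 _ ih => exact nnI (orI2 (ih hΔ))
  | orE _ _ _ ih ih₁ ih₂ =>
    -- The translated disjunction is only known up to ¬¬, but the conclusion is a translated
    -- formula, so stability removes the double negation.
    exact nt_stable (nnMap (ih hΔ)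
      (orE hyp₀ (ih₁ (ext _ hΔ)).weaken₁ (ih₂ (ext _ hΔ)).weaken₁))
  | impI _ ih => exact impI (ih (ext _ hΔ))
  | impE _ _ ih ih' => exact impE (ih hΔ) (ih' hΔ)
  | allI _ ih => exact allI (ih (wk' _ hΔ))
  | allE t _ ih => exact (allE t (ih hΔ)).cast (Fm.nt_subst _ _).symm
  | exI t _ ih => exact nnI (exI t ((ih hΔ).cast (Fm.nt_subst _ _)))
  | exE _ _ ih ih' =>
    exact nt_stable (nnMap (ih hΔ)
      (exE hyp₀ ((ih' (ext _ (wk' _ hΔ))).cast (Fm.nt_subst _ _)).weaken₁))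
  | botE _ ih => exact nt_stable (nnMap (ih hΔ) (botE hyp₀))
  | eqRefl t => exact nnI (eqRefl t)
  | eqSubst A _ _ ih ih' =>
    exact nt_stable (nnMap (ih hΔ) ((eqSubst A.nt hyp₀
      ((ih' hΔ).cast (Fm.nt_subst _ _)).weaken).cast (Fm.nt_subst _ _).symm))
  | conv A e _ ih =>
    exact (conv A.nt e ((ih hΔ).cast (Fm.nt_subst _ _))).cast (Fm.nt_subst _ _).symm
  | succNeZero _ ih => exact nnMap (ih hΔ) (succNeZero hyp₀)
  | succInj _ ih => exact nnMap (ih hΔ) (succInj hyp₀)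
  | ind _ _ ih ih' =>
    refine ind ((ih hΔ).cast (Fm.nt_subst _ _)) ((ih' hΔ).cast ?_)
    simp only [Fm.nt, Fm.step, Fm.nt_subst]
  | lem _ A =>
    -- Falsity is itself translated to ¬¬⊥, so the refutation in the right disjunct has to be
    -- adjusted by `nnI`.
    exact nnMap (nnLem A.nt)
      (orE hyp₀ (orI1 hyp₀) (orI2 (impI (nnI (impE hyp₁ hyp₀)))))
  | ac h A =>
    -- The translated premise is ∀x¬¬∃y: the shift gives ¬¬∀x∃y, and choice is applied under the
    -- double negation.
    refine impI (nnMap (impE (dns (hdns _ _ h) (.ex A.nt)) hyp₀)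
      ((impE (ac (hac _ _ h) A.nt) hyp₀).cast ?_))
    rw [Fm.nt, Fm.nt_subst]
  | dns h A => exact absurd h (hT _)

/-- With the double-negation shift at type `0`, an arithmetical formula implies its negative
translation, which in turn implies its double negation. -/
theorem nt_of_arithmetical (hS : S.dns .nat) (hA : a.Arithmetical) :
    (Entails S Δ A.nt → Entails S Δ A.neg.neg) ∧ (Entails S Δ A → Entails S Δ A.nt) := by
  -- Both implications are needed at once: in the implication case the premise uses the direction
  -- opposite to that of the conclusion.
  induction A generalizing l with
  | eq _ _ => exact ⟨fun h => h, nnI⟩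
  | bot => exact ⟨fun h => h, nnI⟩
  | and _ _ ihA ihB =>
    exact ⟨fun h => nnMap₂ ((ihA hA.1).1 h.andE1) ((ihB hA.2).1 h.andE2) (andI hyp₁ hyp₀),
      fun h => andI ((ihA hA.1).2 h.andE1) ((ihB hA.2).2 h.andE2)⟩
  | or _ _ ihA ihB =>
    exact ⟨fun h => nnBind h (orE hyp₀ (nnMap ((ihA hA.1).1 hyp₀) (orI1 hyp₀))
        (nnMap ((ihB hA.2).1 hyp₀) (orI2 hyp₀))),
      fun h => nnI (orE h (orI1 ((ihA hA.1).2 hyp₀)) (orI2 ((ihB hA.2).2 hyp₀)))⟩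
  | imp _ _ ihA ihB =>
    exact ⟨fun h => nnImp ((ihB hA.2).1 (impE h.weaken ((ihA hA.1).2 hyp₀))),
      fun h => impI (nt_stable (nnMap ((ihA hA.1).1 hyp₀)
        ((ihB hA.2).2 (impE h.weaken.weaken hyp₀))))⟩
  | all _ ih =>
    -- The shift and arithmeticity meet here: the bound variable has type `0`.
    exact ⟨fun h => nnAll (hA.1 ▸ hS) ((ih hA.2).1 h.allE_wk),
      fun h => allI ((ih hA.2).2 h.allE_wk)⟩
  | ex _ ih =>
    exact ⟨fun h => nnBind h (exE hyp₀ (nnMap ((ih hA.2).1 hyp₀) (exI_wk hyp₀))),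
      fun h => nnI (exE h (exI_wk ((ih hA.2).2 hyp₀)))⟩

end Entails

/-! ### From classical proofs to double negations -/

theorem Provable.nn_of_PA_ACω {Γ : Ctx} {a : Form} {A : Fm Γ a} (h : Provable PA_ACω A) :
    Provable HA_ACω_DNSω A.neg.neg :=
  h.elim fun d => Entails.nn_of_deriv (T := PA_ACω) (fun _ _ h => h) (fun _ => trivial) d

/-- The derivation may contain formulas with quantifiers of any type, and the negative translation
handles them all; arithmeticity matters only for the end formula, in passing from its translation to
its double negation. -/
theorem Provable.nn_of_PA_AC0 {Γ : Ctx} {a : Form} {A : Fm Γ a} (hA : a.Arithmetical)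
    (h : Provable PA_AC0 A) : Provable HA_AC0_DNS0 A.neg.neg := by
  obtain ⟨d⟩ := h
  refine (Entails.nt_of_arithmetical (S := HA_AC0_DNS0) rfl hA).1
    (Entails.nt_of_deriv (S := HA_AC0_DNS0) (T := PA_AC0) (fun _ _ h => h) (fun _ _ h => h) (fun _ h => h) d ?_)
  intro b i
  cases i

/-! ### Realizability rules -/

theorem Term.cond_subst {Γ Γ' : Ctx} {σ : Ty} (n : Term Γ .nat) (t u : Term Γ σ)
    (r : Sub Γ Γ') : (Term.cond n t u).subst r = .cond (n.subst r) (t.subst r) (u.subst r) := by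
  simp only [Term.cond, Term.subst, Term.wk_eq, Term.subst_subst, Sub.lift_eq,
    Sub.cons_comp, Sub.shift_comp_cons, Sub.comp_assoc]

/-- The clauses of `mr` for → and ∀ apply the weakened realizer to the fresh variable; for an
abstraction this is a β-redex contracting to its body. -/
theorem Conv.app_wk_lam {Γ : Ctx} {σ τ : Ty} (t : Term (σ :: Γ) τ) :
    Conv (.app ((Term.lam t).wk σ) (.var .zero)) t := by
  have h := Conv.beta (t.rename ((Ren.wk σ).lift σ)) (.var .zero)
  have e : (t.rename ((Ren.wk σ).lift σ)).inst (.var .zero) = t := by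
    rw [Term.inst, Term.subst_rename]
    refine Eq.trans (congrArg t.subst ?_) t.subst_id
    funext τ v
    cases v <;> rfl
  rwa [e] at h

theorem Conv.cond_zero {Γ : Ctx} {σ : Ty} (t u : Term Γ σ) : Conv (.cond .zero t u) t :=
  .primrec_zero _ _

theorem Conv.cond_succ {Γ : Ctx} {σ : Ty} (n : Term Γ .nat) (t u : Term Γ σ) :
    Conv (.cond (.succ n) t u) u := by
  refine (Conv.primrec_succ _ _ _).trans ((Conv.app (.beta _ _) (.refl _)).trans ?_)
  refine (Conv.beta (((u.wk _).wk _).subst ((Sub.cons n (Sub.id Γ)).lift _)) _).trans ?_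
  simp only [Term.inst_eq, Term.wk_eq, Term.subst_subst, Sub.lift_eq, Sub.cons_comp,
    Sub.shift_comp_cons, Sub.comp_assoc, Sub.id_comp, Term.subst_id]
  exact .refl _

/-- Exhibits `mr t A` as an instance of one formula with a variable realizer, so that conversion and
∀-elimination can act on the realizer. -/
theorem mr_var_inst {Γ : Ctx} {a : Form} (t : Term Γ a.rty) (A : Fm Γ a) :
    (mr (.var .zero) (A.wk a.rty)).inst t = mr t A := by
  rw [Fm.inst, mr_subst, Fm.wk_subst_cons, Fm.subst_id]
  rfl

/-- The companion of `mr_var_inst`: the realizer is fixed and the parameter of the realized formula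
varies. -/
theorem mr_wk_inst {Γ : Ctx} {a : Form} {σ : Ty} (t : Term Γ a.rty) (A : Fm (σ :: Γ) a)
    (u : Term Γ σ) : (mr (t.wk σ) A).inst u = mr t (A.inst u) := by
  rw [Fm.inst, mr_subst, ← Term.inst, Term.wk_inst, ← Fm.inst]

namespace Entails

variable {S : Theory} {Γ : Ctx} {l : List Form} {Δ : Hyps Γ l} {a b c : Form}
  {A : Fm Γ a} {B : Fm Γ b} {C : Fm Γ c}

theorem eq_of_conv {t u : Term Γ .nat} (e : Conv t u) : Entails S Δ (.eq t u) := by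
  have h := conv (S := S) (Δ := Δ) (.eq (t.wk _) (.var .zero)) e
  have hi (v : Term Γ .nat) : (Fm.eq (t.wk .nat) (.var .zero)).inst v = .eq t v :=
    congrArg (Fm.eq · v) (t.wk_inst v)
  rw [hi, hi] at h
  exact h (eqRefl t)

theorem eq_symm {t u : Term Γ .nat} (h : Entails S Δ (.eq t u)) : Entails S Δ (.eq u t) := by
  have h' := eqSubst (.eq (.var .zero) (t.wk _)) h
  have hi (v : Term Γ .nat) : (Fm.eq (.var .zero) (t.wk .nat)).inst v = .eq v t :=
    congrArg (Fm.eq v) (t.wk_inst v)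
  rw [hi, hi] at h'
  exact h' (eqRefl t)

theorem eq_trans {t u v : Term Γ .nat} (h : Entails S Δ (.eq t u))
    (h' : Entails S Δ (.eq u v)) : Entails S Δ (.eq t v) := by
  have h'' := eqSubst (.eq (t.wk _) (.var .zero)) h'
  have hi (w : Term Γ .nat) : (Fm.eq (t.wk .nat) (.var .zero)).inst w = .eq t w :=
    congrArg (Fm.eq · w) (t.wk_inst w)
  rw [hi, hi] at h''
  exact h'' h

theorem mr_conv {t u : Term Γ a.rty} (e : Conv t u) (h : Entails S Δ (mr t A)) :
    Entails S Δ (mr u A) :=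
  (conv _ e (h.cast (mr_var_inst t A).symm)).cast (mr_var_inst u A)

theorem mr_impI {t : Term (a.rty :: Γ) b.rty}
    (h : Entails S (.cons (mr (.var .zero) (A.wk a.rty)) (Δ.wk a.rty)) (mr t (B.wk a.rty))) :
    Entails S Δ (mr (a := .imp a b) (.lam t) (.imp A B)) :=
  allI (impI (mr_conv (Conv.app_wk_lam t).symm h))

theorem mr_impE {t : Term Γ (Form.imp a b).rty} {u : Term Γ a.rty}
    (h : Entails S Δ (mr (a := .imp a b) t (.imp A B))) (h' : Entails S Δ (mr u A)) :
    Entails S Δ (mr (a := b) (.app t u) B) := by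
  refine (impE (allE u h) (h'.cast (mr_var_inst u A).symm)).cast ?_
  change (mr (.app (t.wk _) (.var .zero)) (B.wk _)).inst u = _
  rw [Fm.inst, mr_subst, Fm.wk_subst_cons, Fm.subst_id, Term.subst, ← Term.inst, Term.wk_inst]
  rfl

theorem mr_allI {σ : Ty} {A : Fm (σ :: Γ) a} {t : Term (σ :: Γ) a.rty}
    (h : Entails S (Δ.wk σ) (mr t A)) :
    Entails S Δ (mr (a := .all σ a) (.lam t) (.all A)) :=
  allI (mr_conv (Conv.app_wk_lam t).symm h)

theorem mr_allE {σ : Ty} {A : Fm (σ :: Γ) a} {t : Term Γ (Form.all σ a).rty} (u : Term Γ σ)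
    (h : Entails S Δ (mr (a := .all σ a) t (.all A))) :
    Entails S Δ (mr (a := a) (.app t u) (A.inst u)) := by
  refine (allE u h).cast ?_
  rw [Fm.inst, mr_subst, Term.subst, ← Term.inst, Term.wk_inst]
  rfl

theorem mr_exI {σ : Ty} {A : Fm (σ :: Γ) a} {t : Term Γ a.rty} {u : Term Γ σ}
    (h : Entails S Δ (mr t (A.inst u))) :
    Entails S Δ (mr (a := .ex σ a) (.pair t u) (.ex A)) := by
  -- Two conversions are made separately: one in the realizer, one in the witness inside the
  -- formula.
  refine mr_conv (a := a) (Conv.fst_pair t u).symm ?_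
  refine (conv (mr (t.wk σ) A) (Conv.snd_pair t u).symm ?_).cast (mr_wk_inst _ _ _)
  exact h.cast (mr_wk_inst _ _ _).symm

/-- The tag `0` makes the clause for the other disjunct vacuous, so `u` can be arbitrary; in
`mr_orI2` the tag 1 does the same for `t`. -/
theorem mr_orI1 {t : Term Γ a.rty} (u : Term Γ b.rty) (h : Entails S Δ (mr t A)) :
    Entails S Δ (mr (a := .or a b) (.pair (.pair t u) .zero) (.or A B)) :=
  andI (impI (mr_conv ((Conv.fst (.fst_pair _ _)).trans (.fst_pair _ _)).symm h.weaken))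
    (impI (botE (impE hyp₀ (eq_of_conv (.snd_pair _ _)))))

theorem mr_orI2 (t : Term Γ a.rty) {u : Term Γ b.rty} (h : Entails S Δ (mr u B)) :
    Entails S Δ (mr (a := .or a b) (.pair (.pair t u) (.succ .zero)) (.or A B)) :=
  andI (impI (botE (succNeZero (t := .zero)
      (eq_trans (eq_symm (eq_of_conv (.snd_pair _ _))) hyp₀))))
    (impI (mr_conv ((Conv.snd (.fst_pair _ _)).trans (.snd_pair _ _)).symm h.weaken))

/-- Realizers defined by cases. -/
theorem mr_cond {n : Term Γ .nat} {t u : Term Γ a.rty}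
    (h : Entails S Δ (.imp (.eq n .zero) (mr t A)))
    (h' : Entails S Δ (.imp (Fm.neg (.eq n .zero)) (mr u A))) :
    Entails S Δ (mr (.cond n t u) A) := by
  -- The recursor computes only on `0` and successors, while the tag `n` is any term. Hence the
  -- claim is generalized to a variable tag and proved by induction, which serves as a case
  -- distinction.
  let D {Γ' : Ctx} (r : Sub Γ Γ') (m : Term Γ' .nat) :=
    Fm.imp (.imp (.eq m .zero) (mr (t.subst r) (A.subst r)))
      (.imp (.imp (Fm.neg (.eq m .zero)) (mr (u.subst r) (A.subst r)))
        (mr (.cond m (t.subst r) (u.subst r)) (A.subst r)))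
  have hD : ∀ {Γ' : Ctx} (r : Sub Γ Γ') (m : Term Γ' .nat),
      (D (Sub.shift .nat) (.var .zero)).subst (Sub.cons m r) = D r m := by
    intro Γ' r m
    simp only [D, Fm.subst, mr_subst, Term.subst, Term.cond_subst, Term.subst_subst,
      Fm.subst_subst, Sub.shift_comp_cons, Sub.cons_zero]
  have key : Entails S Δ (.all (D (Sub.shift .nat) (.var .zero))) := by
    refine ind (Entails.cast ?_ (hD _ _).symm) (allI (impI (Entails.cast ?_ (hD _ _).symm)))
    · exact impI (impI (mr_conv (Conv.cond_zero _ _).symm (impE hyp₁ (eqRefl _))))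
    · exact impI (impI (mr_conv (Conv.cond_succ _ _ _).symm
        (impE hyp₀ (impI (succNeZero hyp₀)))))
  have h₁ := (allE n key).cast (hD _ _)
  simp only [D, Fm.subst_id, Term.subst_id] at h₁
  exact impE (impE h₁ h) h'

/-- Realizers defined by recursion. -/
theorem mr_ind {A : Fm (.nat :: Γ) a} {t : Term Γ a.rty}
    {u : Term Γ (.arr .nat (.arr a.rty a.rty))} (h : Entails S Δ (mr t (A.inst .zero)))
    (h' : Entails S Δ (mr (a := .all .nat (.imp a a)) u (.all (.imp A A.step)))) :
    Entails S Δ (mr (a := .all .nat a)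
      (.lam (.primrec (t.wk _) (u.wk _) (.var .zero))) (.all A)) := by
  have hD : ∀ {Γ' : Ctx} (r : Sub Γ Γ') (m : Term Γ' .nat),
      (mr (.primrec (t.wk _) (u.wk _) (.var .zero)) A).subst (Sub.cons m r) =
        mr (.primrec (t.subst r) (u.subst r) m) (A.subst (Sub.cons m r)) := by
    intro Γ' r m
    simp only [mr_subst, Term.subst, Term.wk_eq, Term.subst_subst, Sub.shift_comp_cons,
      Sub.cons_zero]
  refine mr_allI (allE_wk (ind (Entails.cast ?_ (hD _ _).symm)
    (allI (impI (Entails.cast ?_ (hD _ _).symm)))))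
  · rw [Term.subst_id]
    exact mr_conv (Conv.primrec_zero _ _).symm h
  -- The recursor equation turns the value at a successor into `u` applied to the predecessor and to
  -- the previous value, which the induction hypothesis realizes.
  · refine mr_conv (Conv.primrec_succ _ _ _).symm ?_
    have h₁ := mr_allE (.var .zero) ((h'.wk .nat).cast (mr_subst _ _ _))
    have h₂ := h₁.cast (congrArg (mr _) (Fm.inst_var_zero (.imp A A.step)))
    refine mr_impE h₂.weaken (hyp₀.cast ?_)
    rw [Term.wk_eq, Term.wk_eq]
    rfl

/-- The realizer of the axiom of choice. -/
theorem mr_acFm {ρ σ : Ty} (A : Fm (σ :: ρ :: Γ) a) :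
    Entails S Δ (mr (a := .imp (.all ρ (.ex σ a)) (.ex (.arr ρ σ) (.all ρ a)))
      (.lam (.pair (.lam (.fst (.app (.var (.succ .zero)) (.var .zero))))
        (.lam (.snd (.app (.var (.succ .zero)) (.var .zero)))))) (acFm A)) := by
  refine mr_impI (A := .all (.ex A)) (B := .ex (.all (A.subst (choiceSub Γ ρ σ))))
    (mr_exI (A := (Fm.all (A.subst (choiceSub Γ ρ σ))).subst ((Sub.shift _).lift _))
      (mr_allI ?_))
  have h₁ := mr_allE (.var .zero) ((wk ρ (hyp₀ (S := S)
    (A := mr (.var .zero) ((Fm.all (.ex A)).wk (Form.all ρ (.ex σ a)).rty))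
    (Δ := Δ.wk _))).cast (mr_subst _ _ _))
  let r : Sub (σ :: ρ :: Γ) (σ :: ρ :: (Form.all ρ (.ex σ a)).rty :: Γ) :=
    ((Sub.shift _).lift ρ).lift σ
  have h₂ := h₁.cast (congrArg (mr _) (Fm.inst_var_zero _))
  -- The premise provides the witness as the second projection of g x, with g its realizer; by β
  -- this is the choice function λx.(gx)₂ applied to x.
  have h₃ := conv (mr (Term.wk σ _) (A.subst r)) (Conv.app_wk_lam _).symm
    (h₂.cast (mr_wk_inst _ _ _).symm)
  refine h₃.cast ((mr_wk_inst _ _ _).trans (congrArg (mr _) ?_))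
  simp only [r, choiceSub_eq, Fm.inst_eq, Fm.subst_subst, Sub.lift_eq, Sub.cons_comp,
    Sub.comp_assoc, Sub.shift_comp_cons, Sub.comp_id, Sub.id_comp, Term.subst, Sub.cons_zero,
    Sub.cons_succ, Sub.shift_apply, Term.wk_eq]
  rfl

/-- Choice is needed with values in the type of realizers of A, which can be any type even for ρ =
0: it collects realizers of the A(x) into one function. -/
theorem bot_of_mr_dns {ρ : Ty} (hρ : S.dns ρ) {A : Fm (ρ :: Γ) a} (hac : S.ac ρ a.rty)
    {t : Term Γ (Form.all ρ a.neg.neg).rty} {u : Term Γ (Form.all ρ a).neg.rty}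
    (ht : Entails S Δ (mr (a := .all ρ a.neg.neg) t (.all A.neg.neg)))
    (hu : Entails S Δ (mr (a := (Form.all ρ a).neg) u (Fm.all A).neg)) :
    Entails S Δ .bot := by
  have h₁ : Entails S (Δ.wk ρ) (Fm.ex (mr (.var .zero) (A.wk a.rty))).neg.neg := by
    have h := mr_allE (.var .zero) ((ht.wk ρ).cast (mr_subst _ _ _))
    have h' := h.cast (congrArg (mr _) (Fm.inst_var_zero A.neg.neg))
    -- If A(x) has no realizer, then any function, here the constant one, realizes ¬A(x), contrary
    -- to the realized ¬¬A(x).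
    exact impI (mr_impE (B := .bot) h'.weaken
      (mr_impI (t := .star) (B := .bot) (impE hyp₁ (exI_wk hyp₀))))
  -- Since the goal is ⊥, the double negation produced by the shift can be dropped; the function
  -- chosen next realizes ∀xA(x), against `u`.
  refine impE (nnAll hρ h₁) (impI (exE (impE (ac hac _) hyp₀) ?_))
  have h₂ := (hu.wk (.arr ρ a.rty)).cast (mr_subst _ _ _)
  refine mr_impE (A := (Fm.all A).wk _) (B := .bot) (u := .var .zero) h₂.weaken.weaken
    (hyp₀.cast (congrArg Fm.all ?_))
  rw [mr_subst, choiceSub_eq, Fm.wk_subst_cons, Sub.lift_eq]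
  rfl

/-- The double-negation shift is realized, by the constant functional, in the presence of the
double-negation shift and of the axiom of choice. -/
theorem mr_dnsFm {ρ : Ty} (hρ : S.dns ρ) (A : Fm (ρ :: Γ) a) (hac : S.ac ρ a.rty) :
    Entails S Δ (mr (a := .imp (.all ρ a.neg.neg) (Form.all ρ a).neg.neg)
      (Term.dflt _) (dnsFm A)) := by
  refine mr_impI (A := .all A.neg.neg) (B := (Fm.all A).neg.neg) (t := .lam .star)
    (mr_impI (A := (Fm.all A).neg.wk _) (B := .bot) (t := .star) ?_)
  exact bot_of_mr_dns hρ hac (hyp₁.cast (mr_subst _ _ _)) hyp₀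

end Entails

/-! ### Soundness of modified realizability -/

/-- The terms `e` realize, in `S` and from the assumptions `Ξ`, the instances of the assumptions
`Δ` under the substitution `r`. -/
def Realizers.Realize (S : Theory) {Γ Γ' : Ctx} {l l' : List Form} (e : Realizers Γ' l)
    (Δ : Hyps Γ l) (r : Sub Γ Γ') (Ξ : Hyps Γ' l') : Prop :=
  ∀ (a : Form) (i : Var l a), Entails S Ξ (mr (e a i) ((Δ.get i).subst r))

namespace Realizers.Realize

variable {S : Theory} {Γ Γ' : Ctx} {l l' : List Form} {e : Realizers Γ' l} {Δ : Hyps Γ l}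
  {r : Sub Γ Γ'} {Ξ : Hyps Γ' l'}

theorem cons (h : e.Realize S Δ r Ξ) {a : Form} {A : Fm Γ a} {t : Term Γ' a.rty}
    (ht : Entails S Ξ (mr t (A.subst r))) : (e.cons t).Realize S (.cons A Δ) r Ξ := by
  intro b i
  cases i with
  | zero => exact ht
  | succ i => exact h b i

theorem weaken (h : e.Realize S Δ r Ξ) {b : Form} (B : Fm Γ' b) :
    e.Realize S Δ r (.cons B Ξ) :=
  fun a i => (h a i).weaken

theorem wk (h : e.Realize S Δ r Ξ) (τ : Ty) : (e.wk τ).Realize S Δ (r.wk τ) (Ξ.wk τ) := by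
  intro a i
  refine ((h a i).wk τ).cast ?_
  rw [Fm.subst_sub_wk, Fm.wk_eq, mr_subst, ← Fm.wk_eq, ← Term.wk_eq]
  rfl

theorem hyps_wk (h : e.Realize S Δ r Ξ) {τ : Ty} (t : Term Γ' τ) :
    e.Realize S (Δ.wk τ) (Sub.cons t r) Ξ := by
  intro a i
  rw [Hyps.get_wk, Fm.wk_subst_cons]
  exact h a i

end Realizers.Realize

open Entails in
/-- Soundness of modified realizability: the extracted term provably realizes the conclusion of
the derivation. -/
theorem Entails.mr_extractAux {S : Theory} (hS : ¬ S.lem)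
    (hac : ∀ ρ σ, S.dns ρ → S.ac ρ σ) {Γ : Ctx} {l : List Form} {Δ : Hyps Γ l} {a : Form}
    {A : Fm Γ a} (d : Deriv S Δ A) {Γ' : Ctx} {l' : List Form} {r : Sub Γ Γ'}
    {e : Realizers Γ' l} {Ξ : Hyps Γ' l'} (he : e.Realize S Δ r Ξ) :
    Entails S Ξ (mr (d.extractAux hS r e) (A.subst r)) := by
  induction d generalizing Γ' l' with
  | hyp i => exact he _ i
  | andI _ _ ih ih' =>
    exact andI (mr_conv (Conv.fst_pair _ _).symm (ih he))
      (mr_conv (Conv.snd_pair _ _).symm (ih' he))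
  | andE1 _ ih => exact andE1 (ih he)
  | andE2 _ ih => exact andE2 (ih he)
  | orI1 _ ih => exact mr_orI1 _ (ih he)
  | orI2 _ ih => exact mr_orI2 _ (ih he)
  | orE _ _ _ ih ih₁ ih₂ =>
    -- Each branch is realized only under its hypothesis on the tag, which releases the matching
    -- component of the realizer of the disjunction.
    exact mr_cond
      (impI (ih₁ ((he.weaken _).cons (impE (andE1 (ih he)).weaken hyp₀))))
      (impI (ih₂ ((he.weaken _).cons (impE (andE2 (ih he)).weaken hyp₀))))
  | impI _ ih =>
    exact mr_impI ((ih (((he.wk _).weaken _).cons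
      (hyp₀.cast (congrArg (mr _) (Fm.subst_sub_wk _ _ _).symm)))).cast
        (congrArg (mr _) (Fm.subst_sub_wk _ _ _)))
  | impE _ _ ih ih' => exact mr_impE (ih he) (ih' he)
  | allI _ ih => exact mr_allI (ih ((he.wk _).hyps_wk _))
  | allE t _ ih =>
    exact (mr_allE (t.subst r) (ih he)).cast (congrArg (mr _) (Fm.subst_inst _ _ _).symm)
  | exI t _ ih => exact mr_exI ((ih he).cast (congrArg (mr _) (Fm.subst_inst _ _ _)))
  | exE _ _ ih ih' =>
    exact (ih' ((he.hyps_wk _).cons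
      ((ih he).cast (congrArg (mr _) (Fm.inst_subst_lift _ _ _))))).cast
        (congrArg (mr _) (Fm.wk_subst_cons _ _ _))
  | botE _ ih => exact botE (ih he)
  | eqRefl t => exact eqRefl _
  | eqSubst A _ _ ih ih' =>
    -- Instantiation does not change the type of realizers, so the same term is kept and replacement
    -- is applied inside the realized formula.
    exact ((eqSubst (mr (Term.wk .nat _) (A.subst (r.lift _))) (ih he)
      (((ih' he).cast (congrArg (mr _) (Fm.subst_inst _ _ _))).cast
        (mr_wk_inst _ _ _).symm)).cast (mr_wk_inst _ _ _)).cast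
          (congrArg (mr _) (Fm.subst_inst _ _ _).symm)
  | conv A c _ ih =>
    exact ((conv (mr (Term.wk _ _) (A.subst (r.lift _))) (c.subst r)
      (((ih he).cast (congrArg (mr _) (Fm.subst_inst _ _ _))).cast
        (mr_wk_inst _ _ _).symm)).cast (mr_wk_inst _ _ _)).cast
          (congrArg (mr _) (Fm.subst_inst _ _ _).symm)
  | succNeZero _ ih => exact succNeZero (ih he)
  | succInj _ ih => exact succInj (ih he)
  | ind _ _ ih ih' =>
    exact mr_ind ((ih he).cast (congrArg (mr _) (Fm.subst_inst _ _ _)))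
      ((ih' he).cast (congrArg (fun B => mr _ (Fm.all (.imp _ B))) (Fm.subst_step _ _)))
  | lem h _ => exact absurd h hS
  | ac _ A =>
    exact (mr_acFm (A.subst ((r.lift _).lift _))).cast
      (congrArg (mr _) (subst_acFm A r).symm)
  | dns h A => exact mr_dnsFm h (A.subst (r.lift _)) (hac _ _ h)

/-- Both theories of the corollary qualify: wherever they have the shift over a type, they have
choice over it with values of every type. -/
theorem Provable.mr_extract {S : Theory} (hS : ¬ S.lem) (hac : ∀ ρ σ, S.dns ρ → S.ac ρ σ)
    {Γ : Ctx} {a : Form} {A : Fm Γ a} (d : Proof S A) : Provable S (mr (d.extract hS) A) := by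
  refine (Entails.mr_extractAux hS hac d (Ξ := Hyps.nil) (fun _ i => ?_)).cast
    (congrArg (mr _) A.subst_id)
  cases i

end HAOmega

open HAOmega in
theorem mainTheorem2 :
    (∀ {Γ : Ctx} {a : Form} (A : Fm Γ a), Provable PA_ACω A →
      Provable HA_ACω_DNSω A.neg.neg ∧
        ∀ d : Proof HA_ACω_DNSω A.neg.neg,
          Provable HA_ACω_DNSω (mr (d.extract not_lem_HA_ACω_DNSω) A.neg.neg)) ∧
    (∀ {Γ : Ctx} {a : Form} (A : Fm Γ a), a.Arithmetical → Provable PA_AC0 A →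
      Provable HA_AC0_DNS0 A.neg.neg ∧
        ∀ d : Proof HA_AC0_DNS0 A.neg.neg,
          Provable HA_AC0_DNS0 (mr (d.extract not_lem_HA_AC0_DNS0) A.neg.neg)) :=
  -- The claim on extracted terms is an instance of soundness, independent of how the double
  -- negation was proved.
  ⟨fun _ h => ⟨h.nn_of_PA_ACω, Provable.mr_extract _ fun _ _ _ => trivial⟩,
    fun _ hA h => ⟨h.nn_of_PA_AC0 hA, Provable.mr_extract _ fun _ _ h => h⟩⟩
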